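/- Let $p$ be an odd prime and let $G$ be a finite group of exponent $p$ and nilpotency class at most two, i.e. $[G,G]\subseteq Z(G)$. Let $n=\operatorname{rank}(G/Z(G))$ and $m=\operatorname{rank}([G,G])$, where the rank of a finite group is the minimal number of generators. A group $G$ is called capable if $G\cong K/Z(K)$ for some group $K$. Define $f$ on positive integers by $$f\left(\binom{T}{2}+s\right)=\binom{T}{3}+\binom{s}{2},\qquad 0\le s\le T,$$ which is well defined, since every positive integer can be written as $\binom{T}{2}+s$ with $0\le s\le T$ and all such representations give the same value. Then: 1. (necessary condition) if $G$ is capable, then $n\le 2m+\binom{m}{2}$; 2. (sufficient condition) if $f\left(\binom{n}{2}-m+1\right)<n$, then $G$ is capable. (Here $m\le\binom{n}{2}$ always holds, so $\binom{n}{2}-m+1$ is a positive integer.) -/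

import Mathlib

/-- A group `G` is capable if it is isomorphic to `K / Z(K)` for some group `K`. -/
def IsCapable.{u} (G : Type u) [Group G] : Prop :=
  ∃ (K : Type u) (_ : Group K), Nonempty (G ≃* K ⧸ Subgroup.center K)

/-- The largest `T` with `T.choose 2 ≤ k`. -/
def triangularRoot (k : ℕ) : ℕ :=
  Nat.findGreatest (fun t => t.choose 2 ≤ k) (k + 1)

/-- The function `f` with `f (T.choose 2 + s) = T.choose 3 + s.choose 2` for `0 ≤ s ≤ T`;
`overlapBound_eq` below shows that this holds for every such representation. -/
def overlapBound (k : ℕ) : ℕ :=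
  (triangularRoot k).choose 3 + (k - (triangularRoot k).choose 2).choose 2

theorem le_choose_two_succ (t : ℕ) : t ≤ (t + 1).choose 2 := by
  rw [Nat.choose_succ_succ' t 1, Nat.choose_one_right]
  exact Nat.le_add_right _ _

theorem triangularRoot_eq (T s : ℕ) (hT : 0 < T) (hs : s < T) :
    triangularRoot (T.choose 2 + s) = T := by
  unfold triangularRoot
  rw [Nat.findGreatest_eq_iff]
  refine ⟨?_, fun _ => Nat.le_add_right _ _, ?_⟩
  · obtain ⟨t, rfl⟩ : ∃ t, T = t + 1 := ⟨T - 1, by omega⟩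
    have := le_choose_two_succ t
    omega
  · intro n hn _ h
    have h1 : (T + 1).choose 2 ≤ n.choose 2 := Nat.choose_le_choose 2 hn
    rw [Nat.choose_succ_succ' T 1, Nat.choose_one_right] at h1
    simp only [Nat.reduceAdd] at h1
    omega

theorem overlapBound_eq (T s : ℕ) (hs : s ≤ T) :
    overlapBound (T.choose 2 + s) = T.choose 3 + s.choose 2 := by
  rcases Nat.lt_or_eq_of_le hs with h | rfl
  · simp only [overlapBound, triangularRoot_eq T s (by omega) h, Nat.add_sub_cancel_left]
  · have e : s.choose 2 + s = (s + 1).choose 2 + 0 := by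
      rw [Nat.choose_succ_succ' s 1, Nat.choose_one_right]
      simp only [Nat.reduceAdd]
      omega
    have e3 : (s + 1).choose 3 = s.choose 2 + s.choose 3 := Nat.choose_succ_succ' s 2
    rw [e]
    simp only [overlapBound, triangularRoot_eq (s + 1) 0 (by omega) (by omega)]
    simp [e3, Nat.add_comm]

/-! The Baer correspondence turns `G` into an 𝔽_p-space `L` with an alternating bracket `B` of class
two. The centre becomes the radical of `B` and `[G,G]` becomes the span W of the brackets, so n =
dim L/ker B and m = dim W. Call a bilinear form t on W × L a Jacobi form if t(B(a,b),c) has zero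
cyclic sum. For `B ≠ 0`, `G` is capable exactly when every nonzero w in W has a Jacobi form with
t(w,·) ≠ 0. Given K/Z(K) ≅ G, commutators in K provide such forms, the Jacobi identity being
Hall–Witt (`exists_jacobi_of_isCapable`). Conversely, a Jacobi form can be corrected to a 2-cocycle
of `G`, whose central extension makes lifts of w noncentral (`isCapable_of_jacobi`).

Necessity is then linear algebra: Jacobi forms cut W down to 0 step by step, and the symmetry they
impose limits the linear conditions needed to force an element of L into the radical
(`finrank_le_of_jacobi`).

For sufficiency put V = L/ker B. Jacobi forms are the functionals on W ⊗ V killing the image of Λ³V.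
If all of them vanish on z ⊗ V, then z ⊗ V lies in that image, giving an at least n-dimensional
space of 3-vectors whose contractions lie in a space of 2-vectors of dimension at most (n choose 2)
− m + 1. Passing to leading monomials bounds such a space by f, as in the Kruskal–Katona theorem
(`finrank_le_overlapBound`), a contradiction. -/

/-! ### Arithmetic of f and the shadow bound for families of triples -/

theorem exists_eq_choose_two_add (k : ℕ) (hk : 0 < k) :
    ∃ T s, 0 < T ∧ s < T ∧ k = T.choose 2 + s := by
  induction k with
  | zero => omega
  | succ k ih =>
    rcases Nat.eq_zero_or_pos k with rfl | h
    · exact ⟨2, 0, by omega, by omega, by decide⟩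
    obtain ⟨T, s, hT, hs, h⟩ := ih h
    by_cases hs' : s + 1 < T
    · exact ⟨T, s + 1, hT, hs', by omega⟩
    · refine ⟨T + 1, 0, by omega, by omega, ?_⟩
      have e : (T + 1).choose 2 = T + T.choose 2 := by
        rw [Nat.choose_succ_succ' T 1, Nat.choose_one_right]
      omega

theorem two_mul_choose_two (a : ℕ) : 2 * a.choose 2 + a = a * a := by
  induction a with
  | zero => rfl
  | succ k ih =>
    have e : (k + 1).choose 2 = k + k.choose 2 := by
      rw [Nat.choose_succ_succ' k 1, Nat.choose_one_right]
    rw [e]; nlinarith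

/-- Convexity of `a ↦ a.choose 2`. -/
theorem choose_two_add_choose_two_le {a b c d : ℕ} (h : a + b = c + d) (hca : c ≤ a)
    (had : a ≤ d) : a.choose 2 + b.choose 2 ≤ c.choose 2 + d.choose 2 := by
  obtain ⟨x, rfl⟩ := Nat.exists_eq_add_of_le hca
  obtain ⟨y, rfl⟩ := Nat.exists_eq_add_of_le had
  obtain rfl : b = c + y := by omega
  have h1 := two_mul_choose_two (c + x)
  have h2 := two_mul_choose_two (c + y)
  have h3 := two_mul_choose_two c
  have h4 := two_mul_choose_two (c + x + y)
  nlinarith [Nat.zero_le (x * y)]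

/-- This is the induction step of the shadow bound: deleting a vertex of degree d from a graph with
e edges. The hypothesis forces d < T for e = (T choose 2) + s, so e − d keeps T if d ≤ s and drops
to T − 1 otherwise; convexity settles both cases. -/
theorem overlapBound_sub_add_le (e d : ℕ) (h : d * (d + 1) ≤ 2 * e) :
    overlapBound (e - d) + d.choose 2 ≤ overlapBound e := by
  rcases Nat.eq_zero_or_pos e with rfl | he
  · have : d = 0 := by
      rcases Nat.eq_zero_or_pos d with h0 | h0
      · exact h0
      · nlinarith
    subst this; simp
  obtain ⟨T, s, hT, hs, rfl⟩ := exists_eq_choose_two_add e he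
  have hT2 := two_mul_choose_two T
  have hd : d < T := by
    by_contra hd
    push Not at hd
    nlinarith
  rw [overlapBound_eq T s hs.le]
  obtain ⟨t, rfl⟩ : ∃ t, T = t + 1 := ⟨T - 1, by omega⟩
  have e2 : (t + 1).choose 2 = t + t.choose 2 := by
    rw [Nat.choose_succ_succ' t 1, Nat.choose_one_right]
  have e3 : (t + 1).choose 3 = t.choose 2 + t.choose 3 := Nat.choose_succ_succ' t 2
  rcases le_or_gt d s with hds | hds
  · rw [Nat.add_sub_assoc hds, overlapBound_eq (t + 1) (s - d) (by omega)]
    have := choose_two_add_choose_two_le (a := s - d) (b := d) (c := 0) (d := s)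
      (by omega) (by omega) (by omega)
    simp only [Nat.choose_zero_succ, zero_add] at this
    omega
  · have h1 : (t + 1).choose 2 + s - d = t.choose 2 + (t + s - d) := by omega
    rw [h1, overlapBound_eq t (t + s - d) (by omega)]
    have := choose_two_add_choose_two_le (a := d) (b := t + s - d) (c := s) (d := t)
      (by omega) (by omega) (by omega)
    omega

/-- A family of `3`-sets whose shadow has at most `e` elements has at most `overlapBound e`
elements. -/
theorem card_le_overlapBound {α : Type*} [Fintype α] [DecidableEq α] (𝒜 ℬ : Finset (Finset α))
    (hA : ∀ S ∈ 𝒜, S.card = 3) (hB : ∀ P ∈ ℬ, P.card = 2)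
    (h : ∀ S ∈ 𝒜, ∀ k ∈ S, S.erase k ∈ ℬ) : 𝒜.card ≤ overlapBound ℬ.card := by
  induction hN : ℬ.card using Nat.strong_induction_on generalizing 𝒜 ℬ with
  | _ N ih =>
  subst hN
  rcases ℬ.eq_empty_or_nonempty with rfl | ⟨P₀, hP₀⟩
  · have : 𝒜 = ∅ := by
      by_contra hne
      obtain ⟨S, hS⟩ := Finset.nonempty_iff_ne_empty.mpr hne
      obtain ⟨k, hk⟩ : S.Nonempty := Finset.card_pos.mp (by rw [hA S hS]; omega)
      simpa using h S hS k hk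
    simp [this]
  let deg : α → ℕ := fun u => (ℬ.filter (fun P => u ∈ P)).card
  obtain ⟨u₀, hu₀⟩ : P₀.Nonempty := Finset.card_pos.mp (by rw [hB P₀ hP₀]; omega)
  -- Delete a vertex v of least positive degree d. It and its d neighbours all have degree at least
  -- d, whence d(d+1) ≤ 2|ℬ|. At most (d choose 2) triples contain v, and the others have their
  -- shadow among the |ℬ| − d pairs avoiding v.
  obtain ⟨v, hv, hmin⟩ := Finset.exists_min_image (Finset.univ.filter (fun u => 0 < deg u)) deg
    ⟨u₀, by simpa [deg, Finset.card_pos] using ⟨P₀, by simp [hP₀, hu₀]⟩⟩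
  have hvpos : 0 < deg v := by simpa using hv
  let N : Finset α := Finset.univ.filter (fun u => u ≠ v ∧ {v, u} ∈ ℬ)
  have hNcard : N.card = deg v := by
    refine Finset.card_bij (fun u _ => {v, u}) ?_ ?_ ?_
    · intro u hu
      simp only [N, Finset.mem_filter] at hu ⊢
      exact ⟨hu.2.2, by simp⟩
    · intro u hu u' hu' heq
      simp only [N, Finset.mem_filter] at hu hu'
      have : u ∈ ({v, u'} : Finset α) := by rw [← heq]; simp
      simpa [hu.2.1] using this
    · intro P hP
      simp only [Finset.mem_filter] at hP
      obtain ⟨a, b, hab, rfl⟩ := Finset.card_eq_two.mp (hB P hP.1)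
      rcases (by simpa using hP.2 : v = a ∨ v = b) with rfl | rfl
      · exact ⟨b, by simp [N, hab.symm, hP.1], rfl⟩
      · exact ⟨a, by simp [N, hab, Finset.pair_comm, hP.1], Finset.pair_comm _ _⟩
  have hdeg : ∀ u ∈ insert v N, deg v ≤ deg u := by
    intro u hu
    refine hmin u ?_
    rcases Finset.mem_insert.mp hu with rfl | hu
    · exact hv
    · simp only [N, Finset.mem_filter, Finset.mem_univ, true_and] at hu ⊢
      exact Finset.card_pos.mpr ⟨{v, u}, by simp [hu.2]⟩
  have hsum : ∑ u, deg u = 2 * ℬ.card := by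
    have := Finset.sum_card_bipartiteAbove_eq_sum_card_bipartiteBelow
      (s := (Finset.univ : Finset α)) (t := ℬ) (fun u P => u ∈ P)
    simp only [Finset.bipartiteAbove, Finset.bipartiteBelow] at this
    rw [show ∑ u, deg u = _ from this, Finset.sum_congr rfl (g := fun _ => 2)]
    · simp [mul_comm]
    · intro P hP
      rw [← hB P hP]; congr 1; ext; simp
  have hvN : v ∉ N := by simp [N]
  have hbound : deg v * (deg v + 1) ≤ 2 * ℬ.card := by
    rw [← hsum]
    calc deg v * (deg v + 1) = ∑ _u ∈ insert v N, deg v := by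
          rw [Finset.sum_const, Finset.card_insert_of_notMem hvN, hNcard]; simp [mul_comm]
      _ ≤ ∑ u ∈ insert v N, deg u := Finset.sum_le_sum hdeg
      _ ≤ ∑ u, deg u := Finset.sum_le_sum_of_subset (Finset.subset_univ _)
  have hBsplit := Finset.card_filter_add_card_filter_not (s := ℬ) (fun P => v ∈ P)
  have hAsplit := Finset.card_filter_add_card_filter_not (s := 𝒜) (fun P => v ∈ P)
  have h1 : (𝒜.filter (fun S => v ∈ S)).card ≤ (deg v).choose 2 := by
    rw [← hNcard, ← Finset.card_powersetCard]
    refine Finset.card_le_card_of_injOn (fun S => S.erase v) ?_ ?_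
    · intro S hS
      simp only [Finset.coe_filter, Set.mem_ofPred_eq] at hS
      simp only [Finset.mem_coe, Finset.mem_powersetCard]
      refine ⟨?_, by rw [Finset.card_erase_of_mem hS.2, hA S hS.1]⟩
      intro u hu
      have hu' := Finset.mem_erase.mp hu
      simp only [N, Finset.mem_filter, Finset.mem_univ, true_and]
      refine ⟨hu'.1, ?_⟩
      have hc : ((S.erase v).erase u).card = 1 := by
        rw [Finset.card_erase_of_mem hu, Finset.card_erase_of_mem hS.2, hA S hS.1]
      obtain ⟨x, hx⟩ := Finset.card_eq_one.mp hc
      have hx' : x ∈ (S.erase v).erase u := by rw [hx]; simp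
      simp only [Finset.mem_erase] at hx'
      have := h S hS.1 x hx'.2.2
      convert this using 1
      have e : S.erase x = insert v (insert u (((S.erase v).erase u).erase x)) := by
        ext y
        simp only [Finset.mem_erase, Finset.mem_insert]
        constructor
        · intro hy; tauto
        · rintro (rfl | rfl | hy)
          · exact ⟨fun hh => hx'.2.1 hh.symm, hS.2⟩
          · exact ⟨fun hh => hx'.1 hh.symm, hu'.2⟩
          · exact ⟨hy.1, hy.2.2.2⟩
      rw [e, hx]; simp
    · intro S hS S' hS' heq
      simp only [Finset.coe_filter, Set.mem_ofPred_eq] at hS hS'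
      have : insert v (S.erase v) = insert v (S'.erase v) := by
        rw [show S.erase v = S'.erase v from heq]
      rwa [Finset.insert_erase hS.2, Finset.insert_erase hS'.2] at this
  have h2 : (𝒜.filter (fun S => ¬ v ∈ S)).card ≤ overlapBound (ℬ.card - deg v) := by
    have hc : (ℬ.filter (fun P => ¬ v ∈ P)).card = ℬ.card - deg v := by
      simp only [deg]; omega
    rw [← hc]
    refine ih _ ?_ _ _ ?_ ?_ ?_ rfl
    · simp only [deg] at hvpos; omega
    · intro S hS; exact hA S (Finset.mem_filter.mp hS).1
    · intro S hS; exact hB S (Finset.mem_filter.mp hS).1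
    · intro S hS k hk
      simp only [Finset.mem_filter] at hS ⊢
      exact ⟨h S hS.1 k hk, fun hh => hS.2 (Finset.mem_of_mem_erase hh)⟩
  have := overlapBound_sub_add_le ℬ.card (deg v) hbound
  omega

/-! ### Leading terms: from set families to spaces of 3-vectors -/

open Module in
-- Restriction to the coordinates in `A` is injective on `Y`: a nonzero vector has an `o`-maximal
-- position in its support, and that position lies in `A`.
theorem finrank_le_card_of_leading {F ι κ : Type*} [Field F] [Finite ι] [LinearOrder κ]
    (o : ι → κ) (Y : Submodule F (ι → F)) (A : Finset ι)
    (h : ∀ y ∈ Y, ∀ s, y s ≠ 0 → (∀ s', o s < o s' → y s' = 0) → s ∈ A) :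
    finrank F Y ≤ A.card := by
  let r : Y →ₗ[F] (A → F) := (LinearMap.funLeft F F (Subtype.val : A → ι)) ∘ₗ Y.subtype
  have hr : Function.Injective r := by
    rw [← LinearMap.ker_eq_bot, LinearMap.ker_eq_bot']
    intro y hy
    by_contra hne
    have hne' : ∃ s, y.1 s ≠ 0 := by
      by_contra hh
      push Not at hh
      exact hne (Subtype.ext (funext hh))
    obtain ⟨s, hs, hmax⟩ := (Set.toFinite {s | y.1 s ≠ 0}).exists_maximalFor o _ hne'
    have hsA : s ∈ A := h y.1 y.2 s hs (fun s' hlt => by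
      by_contra hs'
      exact absurd (hmax hs' hlt.le) (not_le.mpr hlt))
    exact hs (congrFun hy ⟨s, hsA⟩)
  simpa using LinearMap.finrank_le_finrank_of_injective hr

open Module in
-- Vectors with distinct leading positions are independent, by triangularity.
theorem card_le_finrank_of_leading {F ι κ : Type*} [Field F] [Finite ι] [LinearOrder κ]
    (o : ι → κ) (ho : Function.Injective o) (X : Submodule F (ι → F)) (B : Finset ι)
    (h : ∀ s ∈ B, ∃ y ∈ X, y s ≠ 0 ∧ ∀ s', o s < o s' → y s' = 0) :
    B.card ≤ finrank F X := by
  choose! y hyX hy0 hy using h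
  have hli : LinearIndependent F (fun s : B => (⟨y s, hyX s s.2⟩ : X)) := by
    rw [Fintype.linearIndependent_iff]
    intro g hg
    by_contra! hne
    obtain ⟨s, hs, hmax⟩ := (Set.toFinite {s | g s ≠ 0}).exists_maximalFor (fun s => o s.1) _ hne
    have h1 := congrFun (congrArg Subtype.val hg) s.1
    simp only [AddSubmonoidClass.coe_finsetSum, Finset.sum_apply, SetLike.val_smul,
      Pi.smul_apply, smul_eq_mul, ZeroMemClass.coe_zero, Pi.zero_apply] at h1
    rw [Finset.sum_eq_single s] at h1
    · exact (mul_ne_zero hs (hy0 s s.2)) h1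
    · intro b _ hb
      by_cases hgb : g b = 0
      · simp [hgb]
      rcases lt_or_ge (o b.1) (o s.1) with hlt | hge
      · rw [hy b b.2 s hlt, mul_zero]
      · exact absurd (Subtype.ext (ho (le_antisymm (hmax hgb hge) hge))) hb
    · simp
  simpa using hli.fintype_card_le_finrank

/-- The contraction of a `3`-vector by the `k`-th coordinate, with signs `ε`. -/
def contraction {F : Type*} [Field F] {n : ℕ} (ε : Fin n → Finset (Fin n) → F) (k : Fin n) :
    ({S : Finset (Fin n) // S.card = 3} → F) →ₗ[F] ({P : Finset (Fin n) // P.card = 2} → F) where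
  toFun y P := if h : k ∈ P.1 then 0 else
    ε k P.1 * y ⟨insert k P.1, by rw [Finset.card_insert_of_notMem h, P.2]⟩
  map_add' y y' := by
    funext P; by_cases h : k ∈ P.1 <;> simp [h, mul_add]
  map_smul' c y := by
    funext P; by_cases h : k ∈ P.1 <;> simp [h, mul_left_comm]

open Module in
-- Dimensions are counted by colex-leading sets. If y has leading set S and k ∈ S, its contraction
-- by k has leading set S \ {k}, since inserting or erasing a common element preserves colex order.
-- So the leading sets of `Y` have their shadow among those of `X`.
theorem finrank_le_overlapBound {F : Type*} [Field F] {n : ℕ}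
    (ε : Fin n → Finset (Fin n) → F) (hε : ∀ k P, ε k P ≠ 0)
    (Y : Submodule F ({S : Finset (Fin n) // S.card = 3} → F))
    (X : Submodule F ({P : Finset (Fin n) // P.card = 2} → F))
    (h : ∀ y ∈ Y, ∀ k, contraction ε k y ∈ X) :
    finrank F Y ≤ overlapBound (finrank F X) := by
  classical
  let A := Finset.univ.filter (fun S : {S : Finset (Fin n) // S.card = 3} => ∃ y ∈ Y, y S ≠ 0 ∧
    ∀ S', toColex S.1 < toColex S'.1 → y S' = 0)
  let B := Finset.univ.filter (fun P : {P : Finset (Fin n) // P.card = 2} => ∃ y ∈ X, y P ≠ 0 ∧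
    ∀ P', toColex P.1 < toColex P'.1 → y P' = 0)
  have hB : B.card = finrank F X := by
    refine le_antisymm ?_ ?_
    · refine card_le_finrank_of_leading (fun P => toColex P.1)
        (fun P P' hP => Subtype.ext (toColex.injective hP)) X B ?_
      intro s hs
      exact (Finset.mem_filter.mp hs).2
    · refine finrank_le_card_of_leading (fun P => toColex P.1) X B ?_
      intro y hy s hs hs'
      exact Finset.mem_filter.mpr ⟨Finset.mem_univ _, y, hy, hs, hs'⟩
  have hA : finrank F Y ≤ A.card := by
    refine finrank_le_card_of_leading (fun P => toColex P.1) Y A ?_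
    intro y hy s hs hs'
    exact Finset.mem_filter.mpr ⟨Finset.mem_univ _, y, hy, hs, hs'⟩
  rw [← hB]
  refine hA.trans ?_
  have hAi : (A.map ⟨Subtype.val, Subtype.val_injective⟩).card = A.card := Finset.card_map _
  have hBi : (B.map ⟨Subtype.val, Subtype.val_injective⟩).card = B.card := Finset.card_map _
  rw [← hAi, ← hBi]
  refine card_le_overlapBound _ _ ?_ ?_ ?_
  · intro S hS
    simp only [Finset.mem_map, Function.Embedding.coeFn_mk] at hS
    obtain ⟨S, _, rfl⟩ := hS
    exact S.2
  · intro S hS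
    simp only [Finset.mem_map, Function.Embedding.coeFn_mk] at hS
    obtain ⟨S, _, rfl⟩ := hS
    exact S.2
  · intro S hS k hk
    simp only [Finset.mem_map, Function.Embedding.coeFn_mk] at hS ⊢
    obtain ⟨S, hSA, rfl⟩ := hS
    obtain ⟨y, hyY, hyS, hy⟩ := (Finset.mem_filter.mp hSA).2
    refine ⟨⟨S.1.erase k, by rw [Finset.card_erase_of_mem hk, S.2]⟩, ?_, rfl⟩
    refine Finset.mem_filter.mpr ⟨Finset.mem_univ _, _, h y hyY k, ?_, ?_⟩
    · simp only [contraction, LinearMap.coe_mk, AddHom.coe_mk, Finset.mem_erase, ne_eq,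
        not_true_eq_false, false_and, dite_false]
      refine mul_ne_zero (hε _ _) ?_
      convert hyS
      exact Finset.insert_erase hk
    · intro P' hP'
      simp only [contraction, LinearMap.coe_mk, AddHom.coe_mk]
      split_ifs with hk'
      · rfl
      · rw [hy, mul_zero]
        refine (Finset.Colex.toColex_sdiff_lt_toColex_sdiff (u := {k}) (by simpa using hk)
          (by simp)).mp ?_
        rw [Finset.sdiff_singleton_eq_erase, Finset.sdiff_singleton_eq_erase,
          Finset.erase_insert hk']
        exact hP'

/-! ### The numerical condition produces Jacobi forms -/

theorem overlapBound_mono : Monotone overlapBound := by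
  refine monotone_nat_of_le_succ fun e => ?_
  have := overlapBound_sub_add_le (e + 1) 1 (by omega)
  simpa using this

/-- The value on a two-element set `{i < j}` of an alternating function `β`. -/
def pairValue {W : Type*} [AddCommGroup W] {n : ℕ} (β : Fin n → Fin n → W)
    (P : Finset (Fin n)) : W :=
  ∑ i ∈ P, ∑ j ∈ P.filter (i < ·), β i j

theorem pairValue_pair {W : Type*} [AddCommGroup W] {n : ℕ} (β : Fin n → Fin n → W)
    {i j : Fin n} (h : i < j) : pairValue β {i, j} = β i j := by
  unfold pairValue
  rw [Finset.sum_pair h.ne]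
  simp [Finset.filter_insert, Finset.filter_singleton, h, not_lt.mpr h.le]

open Module in
theorem exists_jacobi_of_overlapBound_lt {F W : Type*} [Field F] [AddCommGroup W] [Module F W]
    [FiniteDimensional F W] {n : ℕ} (β : Fin n → Fin n → W) (hanti : ∀ i j, β i j = -β j i)
    (h0 : ∀ i, β i i = 0) (hspan : Submodule.span F {w | ∃ i j, β i j = w} = ⊤)
    (hf : overlapBound (n.choose 2 - finrank F W + 1) < n) (z : W) (hz : z ≠ 0) :
    ∃ t : W →ₗ[F] (Fin n → F) →ₗ[F] F,
      (∀ i j k, t (β i j) (Pi.single k 1) + t (β j k) (Pi.single i 1)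
        + t (β k i) (Pi.single j 1) = 0) ∧ t z ≠ 0 := by
  classical
  let ε : Fin n → Finset (Fin n) → F := fun k P => (-1) ^ (P.filter (· < k)).card
  have hε : ∀ k P, ε k P ≠ 0 := fun k P => pow_ne_zero _ (by simp)
  let b : ({P : Finset (Fin n) // P.card = 2} → F) →ₗ[F] W :=
    Fintype.linearCombination F (fun P => pairValue β P.1)
  have hb : ∀ P : {P : Finset (Fin n) // P.card = 2}, b (Pi.single P 1) = pairValue β P.1 :=
    fun P => by simp [b, Fintype.linearCombination_apply_single]
  have hbsurj : LinearMap.range b = ⊤ := by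
    rw [eq_top_iff, ← hspan, Submodule.span_le]
    rintro _ ⟨i, j, rfl⟩
    have key : ∀ i j, i < j → β i j ∈ LinearMap.range b := fun i j hij =>
      ⟨Pi.single ⟨{i, j}, Finset.card_pair hij.ne⟩ 1, by rw [hb]; exact pairValue_pair β hij⟩
    rcases lt_trichotomy i j with hij | rfl | hij
    · exact key i j hij
    · rw [h0]; exact zero_mem _
    · rw [hanti]; exact neg_mem (key j i hij)
  -- `Fin n → W` plays the role of W ⊗ V, with `Pi.single k z` as z ⊗ e_k, and `q` is the composite
  -- Λ³V → Λ²V ⊗ V → W ⊗ V.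
  let q : ({S : Finset (Fin n) // S.card = 3} → F) →ₗ[F] (Fin n → W) :=
    LinearMap.pi fun k => b ∘ₗ contraction ε k
  by_cases hall : ∀ k, (Pi.single k z : Fin n → W) ∈ LinearMap.range q
  · exfalso
    let X := LinearMap.ker ((F ∙ z).mkQ ∘ₗ b)
    let Y := LinearMap.ker (LinearMap.pi fun k => (F ∙ z).mkQ ∘ₗ b ∘ₗ contraction ε k)
    have hYX := finrank_le_overlapBound ε hε Y X (by
      intro y hy k
      exact congrFun hy k)
    have hX : finrank F X ≤ n.choose 2 - finrank F W + 1 := by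
      have h1 := LinearMap.finrank_range_add_finrank_ker ((F ∙ z).mkQ ∘ₗ b)
      rw [LinearMap.range_comp, hbsurj, Submodule.map_top, Submodule.range_mkQ, finrank_top] at h1
      have h2 := (F ∙ z).finrank_quotient_add_finrank
      rw [finrank_span_singleton hz] at h2
      have h3 : finrank F ({P : Finset (Fin n) // P.card = 2} → F) = n.choose 2 := by simp
      have h4 : finrank F X = finrank F (LinearMap.ker ((F ∙ z).mkQ ∘ₗ b)) := rfl
      omega
    -- Preimages under `q` of the n independent tensors z ⊗ e_k are independent and have all
    -- contractions in `X`.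
    have hY : n ≤ finrank F Y := by
      choose y hy using hall
      have hyY : ∀ k, y k ∈ Y := by
        intro k
        rw [LinearMap.mem_ker]
        funext l
        have := congrFun (hy k) l
        simp only [q, LinearMap.pi_apply, LinearMap.comp_apply] at this ⊢
        rw [this]
        by_cases hkl : l = k
        · subst hkl
          simp
        · simp [hkl]
      have hli : LinearIndependent F (fun k => (⟨y k, hyY k⟩ : Y)) := by
        refine LinearIndependent.of_comp (q ∘ₗ Y.subtype) ?_
        rw [Fintype.linearIndependent_iff]
        intro g hg k
        have := congrFun hg k
        simp only [Function.comp_apply, LinearMap.comp_apply, Submodule.subtype_apply, hy,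
          Finset.sum_apply, Pi.smul_apply, Pi.zero_apply] at this
        rw [Finset.sum_eq_single k (fun l _ hl => by rw [Pi.single_eq_of_ne hl.symm, smul_zero])
          (fun h => absurd (Finset.mem_univ k) h)] at this
        simpa [hz] using this
      simpa using hli.fintype_card_le_finrank
    exact absurd (hY.trans (hYX.trans (overlapBound_mono hX))) (not_le.mpr hf)
  push Not at hall
  obtain ⟨k₀, hk₀⟩ := hall
  -- A functional killing the image of `q` but not z ⊗ e_k₀ is the required Jacobi form.
  obtain ⟨φ, hφ0, hφ⟩ := Submodule.exists_le_ker_of_notMem hk₀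
  let t : W →ₗ[F] (Fin n → F) →ₗ[F] F := LinearMap.mk₂ F (fun w v => φ (fun k => v k • w))
    (by intro w w' v; rw [← map_add]; congr 1; funext k; simp)
    (by intro c w v; rw [← map_smul]; congr 1; funext k; exact smul_comm _ _ _)
    (by intro w v v'; rw [← map_add]; congr 1; funext k; simp [add_smul])
    (by intro c w v; rw [← map_smul]; congr 1; funext k; simp [mul_smul])
  have ht : ∀ w k, t w (Pi.single k 1) = φ (Pi.single k w) := by
    intro w k
    simp only [t, LinearMap.mk₂_apply]
    congr 1
    funext l
    by_cases hl : l = k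
    · subst hl; simp
    · simp [hl]
  refine ⟨t, ?_, ?_⟩
  · have hc : ∀ (S : {S : Finset (Fin n) // S.card = 3}) (k : Fin n)
        (P : {P : Finset (Fin n) // P.card = 2}), k ∉ P.1 → insert k P.1 = S.1 →
        q (Pi.single S 1) k = ε k P.1 • pairValue β P.1 := by
      intro S k P hk hS
      have : contraction ε k (Pi.single S 1) = ε k P.1 • (Pi.single P 1) := by
        funext P'
        simp only [contraction, LinearMap.coe_mk, AddHom.coe_mk, Pi.smul_apply, smul_eq_mul]
        by_cases hP : P' = P
        · subst hP
          rw [dif_neg hk, show (⟨insert k P'.1, _⟩ : {S : Finset (Fin n) // S.card = 3}) = S from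
            Subtype.ext hS]
          simp
        · rw [Pi.single_eq_of_ne hP, mul_zero]
          split_ifs with hk'
          · rfl
          · rw [Pi.single_eq_of_ne, mul_zero]
            intro hh
            apply hP
            have h1 := congrArg Subtype.val hh
            simp only at h1
            rw [← hS] at h1
            apply Subtype.ext
            rw [← Finset.erase_insert hk', h1, Finset.erase_insert hk]
      simp only [q, LinearMap.pi_apply, LinearMap.comp_apply, this, map_smul, hb]
    have hc0 : ∀ (S : {S : Finset (Fin n) // S.card = 3}) (k : Fin n), k ∉ S.1 →
        q (Pi.single S 1) k = 0 := by
      intro S k hk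
      have : contraction ε k (Pi.single S (1 : F)) = 0 := by
        funext P'
        simp only [contraction, LinearMap.coe_mk, AddHom.coe_mk, Pi.zero_apply]
        split_ifs with hk'
        · rfl
        · rw [Pi.single_eq_of_ne, mul_zero]
          intro hh
          apply hk
          rw [← hh]
          simp
      simp only [q, LinearMap.pi_apply, LinearMap.comp_apply, this, map_zero]
    have hsorted : ∀ i j k, i < j → j < k → t (β i j) (Pi.single k 1)
        + t (β j k) (Pi.single i 1) + t (β k i) (Pi.single j 1) = 0 := by
      intro i j k hij hjk
      have hik := hij.trans hjk
      have hS : ({i, j, k} : Finset (Fin n)).card = 3 :=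
        Finset.card_eq_three.mpr ⟨i, j, k, hij.ne, hik.ne, hjk.ne, rfl⟩
      have e : q (Pi.single ⟨{i, j, k}, hS⟩ 1) =
          Pi.single k (β i j) + Pi.single i (β j k) + Pi.single j (β k i) := by
        funext l
        by_cases hl : l ∈ ({i, j, k} : Finset (Fin n))
        · simp only [Finset.mem_insert, Finset.mem_singleton] at hl
          rcases hl with rfl | rfl | rfl
          · rw [hc _ l ⟨{j, k}, Finset.card_pair hjk.ne⟩ (by simp [hij.ne, hik.ne]) rfl,
              pairValue_pair β hjk]
            simp [ε, Finset.filter_insert, Finset.filter_singleton, hij.not_gt, hik.not_gt,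
              hij.ne, hik.ne]
          · rw [hc _ l ⟨{i, k}, Finset.card_pair hik.ne⟩ (by simp [hij.ne', hjk.ne])
              (Finset.insert_comm _ _ _), pairValue_pair β hik, hanti i k]
            simp [ε, Finset.filter_insert, Finset.filter_singleton, hij, hjk.not_gt,
              hij.ne', hjk.ne]
          · rw [hc _ l ⟨{i, j}, Finset.card_pair hij.ne⟩ (by simp [hjk.ne', hik.ne'])
              (by ext x; simp; tauto), pairValue_pair β hij]
            simp [ε, Finset.filter_insert, Finset.filter_singleton, hik, hjk,
              hik.ne', hjk.ne', hij.ne]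
        · rw [hc0 _ l hl]
          simp only [Finset.mem_insert, Finset.mem_singleton, not_or] at hl
          simp [hl.1, hl.2.1, hl.2.2]
      rw [ht, ht, ht, ← map_add, ← map_add, ← e]
      exact hφ ⟨_, rfl⟩
    -- The cyclic sum is alternating in the three indices, so increasing triples suffice.
    have hrep : ∀ i k, t (β i i) (Pi.single k 1) + t (β i k) (Pi.single i 1)
        + t (β k i) (Pi.single i 1) = 0 := by
      intro i k
      rw [h0, hanti i k]; simp
    have hle : ∀ i j k, i ≤ j → j ≤ k → t (β i j) (Pi.single k 1)
        + t (β j k) (Pi.single i 1) + t (β k i) (Pi.single j 1) = 0 := by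
      intro i j k hij hjk
      rcases hij.eq_or_lt with rfl | hij
      · exact hrep i k
      rcases hjk.eq_or_lt with rfl | hjk
      · rw [← hrep j i]; abel
      exact hsorted i j k hij hjk
    have hswap : ∀ i j k, t (β i j) (Pi.single k 1) + t (β j k) (Pi.single i 1)
        + t (β k i) (Pi.single j 1) = -(t (β j i) (Pi.single k 1) + t (β i k) (Pi.single j 1)
        + t (β k j) (Pi.single i 1)) := by
      intro i j k
      rw [hanti i j, hanti j k, hanti k i]
      simp only [map_neg, LinearMap.neg_apply]; abel
    intro i j k
    rcases le_total i j with hij | hij <;> rcases le_total j k with hjk | hjk <;>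
      rcases le_total i k with hik | hik
    · exact hle i j k hij hjk
    · exact hle i j k hij hjk
    · rw [hswap, neg_eq_zero, ← hle i k j hik hjk]; abel
    · rw [← hle k i j hik hij]; abel
    · rw [hswap, neg_eq_zero, ← hle j i k hij hik]
    · rw [← hle j k i hjk hik]; abel
    · rw [hswap, neg_eq_zero, ← hle k j i hjk hij]; abel
    · rw [hswap, neg_eq_zero, ← hle k j i hjk hij]; abel
  · intro h
    apply hφ0
    rw [← ht, h]; rfl

/-! ### The dimension bound for the necessary condition -/

open Module in
theorem finrank_le_finrank_inf_ker_add {F L M : Type*} [Field F] [AddCommGroup L] [Module F L]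
    [FiniteDimensional F L] [AddCommGroup M] [Module F M] [FiniteDimensional F M]
    (f : L →ₗ[F] M) (E : Submodule F L) (R : Submodule F M) (h : ∀ x ∈ E, f x ∈ R) :
    finrank F E ≤ finrank F (E ⊓ LinearMap.ker f : Submodule F L) + finrank F R := by
  have h1 := LinearMap.finrank_range_add_finrank_ker (f.domRestrict E)
  have h2 : (LinearMap.ker (f.domRestrict E)).map E.subtype = E ⊓ LinearMap.ker f := by
    rw [← Submodule.map_comap_subtype]; rfl
  rw [← h2, LinearEquiv.finrank_eq (Submodule.equivSubtypeMap _ _).symm]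
  have h3 : finrank F (LinearMap.range (f.domRestrict E)) ≤ finrank F R := by
    refine Submodule.finrank_mono ?_
    rintro _ ⟨x, rfl⟩
    exact h x x.2
  omega

/-- A pairing whose left radical has codimension `r` is separated on the left by at most `r`
vectors on the right. -/
theorem exists_separating_vectors {F L W : Type*} [Field F] [AddCommGroup L] [Module F L]
    [AddCommGroup W] [Module F W] [FiniteDimensional F W] (t : W →ₗ[F] L →ₗ[F] F) :
    ∃ (s : ℕ) (b : Fin s → L), s + Module.finrank F (LinearMap.ker t) ≤ Module.finrank F W ∧
      ∀ w, (∀ i, t w (b i) = 0) → t w = 0 := by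
  -- The forms t(·, x) annihilate the left radical, so they span a space of dimension at most its
  -- codimension; the chosen vectors represent a basis of that space.
  let R : Submodule F (Module.Dual F W) := LinearMap.range t.flip
  have hR : R ≤ (LinearMap.ker t).dualAnnihilator := by
    rintro _ ⟨x, rfl⟩
    rw [Submodule.mem_dualAnnihilator]
    intro w hw
    rw [LinearMap.flip_apply, LinearMap.mem_ker.mp hw]; rfl
  have : Module.Free F R := Module.Free.of_divisionRing F R
  let e := Module.finBasis F R
  choose b hb using fun i => (e i).2
  refine ⟨Module.finrank F R, b, ?_, ?_⟩
  · have := Subspace.finrank_add_finrank_dualAnnihilator_eq (LinearMap.ker t)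
    have := Submodule.finrank_mono hR
    omega
  · intro w hw
    ext x
    have hx : (⟨t.flip x, x, rfl⟩ : R) ∈ Submodule.span F (Set.range e) := by
      rw [e.span_eq]; trivial
    have hle : Submodule.span F (Set.range e) ≤
        LinearMap.ker ((LinearMap.applyₗ w) ∘ₗ R.subtype) := by
      rw [Submodule.span_le]
      rintro _ ⟨i, rfl⟩
      have := hw i
      rw [← LinearMap.flip_apply, hb] at this
      exact this
    exact hle hx

theorem choose_two_add_add_one (k r : ℕ) :
    (k + r + 1).choose 2 = (k + 1).choose 2 + (r + 1).choose 2 + k * r := by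
  have h1 := two_mul_choose_two (k + r + 1)
  have h2 := two_mul_choose_two (k + 1)
  have h3 := two_mul_choose_two (r + 1)
  nlinarith

open Module in
/-- If the Jacobi forms of an alternating map `B : L × L → W` separate the points of `W`, then the
codimension of the radical of `B` is at most `m + (m + 1).choose 2`, where `m = dim W`. -/
theorem finrank_le_of_jacobi {F L W : Type*} [Field F] [AddCommGroup L] [Module F L]
    [FiniteDimensional F L] [AddCommGroup W] [Module F W] [FiniteDimensional F W]
    (B : L →ₗ[F] L →ₗ[F] W) (hB : ∀ x, B x x = 0)
    (hJ : ∀ w ≠ 0, ∃ t : W →ₗ[F] L →ₗ[F] F,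
      (∀ a b c, t (B a b) c + t (B b c) a + t (B c a) b = 0) ∧ t w ≠ 0) :
    finrank F L ≤ finrank F (LinearMap.ker B) + (finrank F W + (finrank F W + 1).choose 2) := by
  have hanti : ∀ x y, B x y = -B y x := by
    intro x y
    have := hB (x + y)
    simp only [map_add, LinearMap.add_apply, hB, zero_add, add_zero] at this
    exact eq_neg_of_add_eq_zero_right this
  -- `E W'` interpolates between L (at W' = ⊤) and a subspace of the radical (at W' = ⊥). The
  -- induction bounds its dimension with the potential k + (k+1 choose 2), where k is the
  -- codimension of W'.
  let E : Submodule F W → Submodule F L := fun W' => ⨅ a, W'.comap (B a)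
  have hE : ∀ W' c, c ∈ E W' ↔ ∀ a, B a c ∈ W' := by
    intro W' c; simp [E, Submodule.mem_iInf]
  suffices H : ∀ (d : ℕ) (W' : Submodule F W), finrank F W' = d →
      finrank F (E W') + ((finrank F W - d) + (finrank F W - d + 1).choose 2) ≤
        finrank F (LinearMap.ker B) + (finrank F W + (finrank F W + 1).choose 2) by
    have h1 := H (finrank F W) ⊤ (finrank_top F W)
    have h2 : E ⊤ = ⊤ := by ext; simp [hE]
    rw [h2, finrank_top] at h1
    omega
  intro d
  induction d using Nat.strong_induction_on with
  | _ d ih =>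
  intro W' hW'
  rcases eq_or_ne W' ⊥ with rfl | hne
  · rw [finrank_bot] at hW'
    subst hW'
    have : E ⊥ ≤ LinearMap.ker B := by
      intro c hc
      rw [hE] at hc
      rw [LinearMap.mem_ker]
      ext a
      rw [hanti, (Submodule.mem_bot F).mp (hc a), neg_zero]; rfl
    have := Submodule.finrank_mono this
    simp only [Nat.sub_zero]
    omega
  obtain ⟨w, hw, hw0⟩ := Submodule.exists_mem_ne_zero_of_ne_bot hne
  obtain ⟨t, ht, htw⟩ := hJ w hw0
  let t' := t ∘ₗ W'.subtype
  obtain ⟨s, b, hs, hb⟩ := exists_separating_vectors t'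
  let W'' := (LinearMap.ker t').map W'.subtype
  have hW'' : finrank F W'' = finrank F (LinearMap.ker t') :=
    LinearEquiv.finrank_eq (Submodule.equivSubtypeMap _ _).symm
  have hle : W'' ≤ W' := Submodule.map_subtype_le _ _
  have hlt : W'' < W' := by
    refine lt_of_le_of_ne hle fun h => htw ?_
    rw [← h] at hw
    obtain ⟨x, hx, rfl⟩ := hw
    exact hx
  have hker : W'' ≤ LinearMap.ker t := by
    rintro _ ⟨x, hx, rfl⟩
    exact hx
  have hd : finrank F W'' < d := by rw [← hW']; exact Submodule.finrank_lt_finrank_of_lt hlt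
  have hdm : d ≤ finrank F W := hW' ▸ Submodule.finrank_le W'
  have h1 := ih _ hd W'' rfl
  -- Requiring t(u, c) = 0 for all u costs at most codim W'' conditions, because t already vanishes
  -- on W''.
  have h2 : finrank F (E W') ≤ finrank F (E W' ⊓ LinearMap.ker t.flip : Submodule F L) +
      (finrank F W - finrank F W'') := by
    refine (finrank_le_finrank_inf_ker_add (M := Dual F W) t.flip (E W') W''.dualAnnihilator ?_).trans ?_
    · intro x _
      rw [Submodule.mem_dualAnnihilator]
      intro u hu
      rw [LinearMap.flip_apply, LinearMap.mem_ker.mp (hker hu)]; rfl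
    · have := Subspace.finrank_add_finrank_dualAnnihilator_eq W''
      omega
  -- Once t(·, c) = 0, the Jacobi identity makes (a, a') ↦ t(B(a,c), a') symmetric. It then vanishes
  -- as soon as it does on unordered pairs from the s separating vectors, which puts every B(a,c) in
  -- W''.
  have h3 : finrank F (E W' ⊓ LinearMap.ker t.flip : Submodule F L) ≤
      finrank F (E W'') + (s + 1).choose 2 := by
    let M : L →ₗ[F] (Sym2 (Fin s) → F) :=
      LinearMap.pi fun σ => t.flip (b σ.sup) ∘ₗ B (b σ.inf)
    refine (finrank_le_finrank_inf_ker_add M _ ⊤ (fun _ _ => trivial)).trans ?_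
    have hM : finrank F (⊤ : Submodule F (Sym2 (Fin s) → F)) = (s + 1).choose 2 := by
      simp [Sym2.card]
    rw [hM]
    refine Nat.add_le_add_right (Submodule.finrank_mono ?_) _
    rintro c ⟨⟨hcE, hct⟩, hcM⟩
    have hcE' := (hE W' c).mp hcE
    have hct' : ∀ u, t u c = 0 := fun u => LinearMap.congr_fun (LinearMap.mem_ker.mp hct) u
    have hsymm : ∀ a a', t (B a c) a' = t (B a' c) a := by
      intro a a'
      have := ht a c a'
      rw [hct', add_zero, hanti c a', map_neg, LinearMap.neg_apply, ← sub_eq_add_neg] at this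
      exact sub_eq_zero.mp this
    have hij : ∀ i j, i ≤ j → t (B (b i) c) (b j) = 0 := by
      intro i j hij
      have := congrFun (LinearMap.mem_ker.mp hcM) s(i, j)
      simpa [M, hij] using this
    have hij' : ∀ i j, t (B (b i) c) (b j) = 0 := by
      intro i j
      rcases le_total i j with h | h
      · exact hij i j h
      · rw [hsymm]; exact hij j i h
    have hti : ∀ i, t (B (b i) c) = 0 := fun i =>
      hb ⟨B (b i) c, hcE' _⟩ (fun j => hij' i j)
    rw [hE]
    intro a
    refine ⟨⟨B a c, hcE' a⟩, hb _ fun i => ?_, rfl⟩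
    change t (B a c) (b i) = 0
    rw [hsymm, hti]; rfl
  obtain ⟨k, hk⟩ := Nat.exists_eq_add_of_le hdm
  obtain ⟨r, hr⟩ := Nat.exists_eq_add_of_lt hd
  have hsr : s ≤ r + 1 := by omega
  have h4 : (s + 1).choose 2 ≤ (r + 1 + 1).choose 2 := Nat.choose_le_choose 2 (by omega)
  have h5 := choose_two_add_add_one k (r + 1)
  have e1 : finrank F W - d = k := by omega
  have e2 : finrank F W - finrank F W'' = k + (r + 1) := by omega
  rw [e2] at h1 h2
  rw [e1]
  -- The cost k + (r+1) + (r+2 choose 2) fits into the growth of the potential, whose cross term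
  -- k(r+1) absorbs k.
  have : k * (r + 1) = k * r + k := by ring
  omega

/-! ### The Baer correspondence -/

open scoped commutatorElement

theorem commutatorElement_mul_left_of_central {G : Type*} [Group G]
    (hc : ∀ x y z : G, ⁅x, y⁆ * z = z * ⁅x, y⁆) (x y z : G) : ⁅x * y, z⁆ = ⁅x, z⁆ * ⁅y, z⁆ := by
  have : ⁅x * y, z⁆ = x * ⁅y, z⁆ * x⁻¹ * ⁅x, z⁆ := by simp only [commutatorElement_def]; group
  rw [this, mul_assoc x, hc, mul_inv_cancel_left, hc]

theorem commutatorElement_mul_right_of_central {G : Type*} [Group G]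
    (hc : ∀ x y z : G, ⁅x, y⁆ * z = z * ⁅x, y⁆) (x y z : G) : ⁅x, y * z⁆ = ⁅x, y⁆ * ⁅x, z⁆ := by
  rw [← commutatorElement_inv, commutatorElement_mul_left_of_central hc, mul_inv_rev,
    commutatorElement_inv, commutatorElement_inv, hc]

/-- The Baer correspondence: a group of class at most two and odd prime exponent is a vector space
with an alternating bracket. -/
theorem exists_baer.{u} (p : ℕ) [Fact p.Prime] (hodd : Odd p) (G : Type u) [Group G]
    (hexp : ∀ g : G, g ^ p = 1) (hclass : commutator G ≤ Subgroup.center G) :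
    ∃ (L : Type u) (_ : AddCommGroup L) (_ : Module (ZMod p) L) (e : G ≃ L)
      (B : L →ₗ[ZMod p] L →ₗ[ZMod p] L), (∀ x, B x x = 0) ∧ (∀ x y z, B (B x y) z = 0) ∧
      (∀ x y, e (x * y) = e x + e y + (2 : ZMod p)⁻¹ • B (e x) (e y)) ∧
      (∀ x y, e ⁅x, y⁆ = B (e x) (e y)) := by
  obtain ⟨k, hk⟩ := hodd
  have hc : ∀ x y z : G, ⁅x, y⁆ * z = z * ⁅x, y⁆ := fun x y z =>
    (Subgroup.mem_center_iff.mp (hclass (Subgroup.commutator_mem_commutator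
      (Subgroup.mem_top x) (Subgroup.mem_top y))) z).symm
  have hml := commutatorElement_mul_left_of_central hc
  have hmr := commutatorElement_mul_right_of_central hc
  have hpc : ∀ (x y z : G) (n : ℕ), ⁅x, y⁆ ^ n * z = z * ⁅x, y⁆ ^ n := fun x y z n =>
    (Commute.pow_left (hc x y z) n).eq
  have hcl : ∀ (x y z : G) (n : ℕ), ⁅⁅x, y⁆ ^ n, z⁆ = 1 := fun x y z n =>
    commutatorElement_eq_one_iff_commute.mpr (hpc x y z n)
  have hcr : ∀ (x y z : G) (n : ℕ), ⁅z, ⁅x, y⁆ ^ n⁆ = 1 := fun x y z n =>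
    commutatorElement_eq_one_iff_commute.mpr (hpc x y z n).symm
  have hcl1 : ∀ (x y z : G), ⁅⁅x, y⁆, z⁆ = 1 := fun x y z => by simpa using hcl x y z 1
  have hcr1 : ∀ (x y z : G), ⁅z, ⁅x, y⁆⁆ = 1 := fun x y z => by simpa using hcr x y z 1
  have hmp : ∀ (x y x' y' : G) (n : ℕ), (⁅x, y⁆ * ⁅x', y'⁆) ^ n = ⁅x, y⁆ ^ n * ⁅x', y'⁆ ^ n :=
    fun x y x' y' n => Commute.mul_pow (hc x y _) n
  -- As p = 2k + 1, the exponent k + 1 is one half modulo p: the sum is xy[y,x]^{1/2}.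
  let add : G → G → G := fun x y => x * y * ⁅y, x⁆ ^ (k + 1)
  have hadd : ∀ x y, add x y = x * y * ⁅y, x⁆ ^ (k + 1) := fun _ _ => rfl
  have hcomm : ∀ x y, add x y = add y x := by
    intro x y
    have h1 : y * x = x * y * ⁅y, x⁆ := by
      rw [← hc]; simp only [commutatorElement_def]; group
    have h2 : ⁅x, y⁆ ^ (k + 1) = ⁅y, x⁆ ^ k := by
      rw [← commutatorElement_inv, inv_pow, inv_eq_iff_mul_eq_one, ← pow_add,
        show k + 1 + k = p by omega, hexp]
    rw [hadd, hadd, h1, h2, pow_succ', mul_assoc (x * y)]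
  have hassoc : ∀ x y z, add (add x y) z = add x (add y z) := by
    intro x y z
    simp only [hadd, hml, hmr, hcl, hcr, mul_one, hmp]
    have h1 := hpc y x
    have h2 := hpc z y
    calc x * y * ⁅y, x⁆ ^ (k + 1) * z * (⁅z, x⁆ ^ (k + 1) * ⁅z, y⁆ ^ (k + 1))
        = x * y * (⁅y, x⁆ ^ (k + 1) * (z * (⁅z, x⁆ ^ (k + 1) * ⁅z, y⁆ ^ (k + 1)))) := by group
      _ = x * y * (z * (⁅z, y⁆ ^ (k + 1) * (⁅z, x⁆ ^ (k + 1))) * ⁅y, x⁆ ^ (k + 1)) := by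
          rw [h1, ← h2 (⁅z, x⁆ ^ (k + 1))]
      _ = x * (y * z * ⁅z, y⁆ ^ (k + 1)) * (⁅z, x⁆ ^ (k + 1) * ⁅y, x⁆ ^ (k + 1)) := by
          simp only [mul_assoc]
      _ = _ := by rw [← h1 (⁅z, x⁆ ^ (k + 1))]
  have hself : ∀ (x : G) (n : ℕ), ⁅x, x ^ n⁆ = 1 := fun x n =>
    commutatorElement_eq_one_iff_commute.mpr (Commute.self_pow x n)
  let inst : AddCommGroup G :=
    { add := add
      zero := 1
      neg := fun x => x⁻¹
      add_assoc := hassoc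
      zero_add := fun x => by
        change add 1 x = x
        simp [hadd]
      add_zero := fun x => by
        change add x 1 = x
        simp [hadd]
      add_comm := hcomm
      neg_add_cancel := fun x => by
        change add x⁻¹ x = 1
        have : ⁅x, x⁻¹⁆ = 1 := commutatorElement_eq_one_iff_commute.mpr (Commute.refl x).inv_right
        rw [hadd, this]; simp
      nsmul := fun n x => x ^ n
      nsmul_zero := fun x => pow_zero x
      nsmul_succ := fun n x => by
        change x ^ (n + 1) = add (x ^ n) x
        rw [hadd, hself, one_pow, mul_one, pow_succ]
      zsmul := fun n x => x ^ n
      zsmul_zero' := fun x => zpow_zero x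
      zsmul_succ' := fun n x => by
        change x ^ ((n.succ : ℕ) : ℤ) = add (x ^ (n : ℤ)) x
        rw [zpow_natCast, zpow_natCast, hadd, hself, one_pow, mul_one, pow_succ]
      zsmul_neg' := fun n x => by
        change x ^ Int.negSucc n = (x ^ ((n.succ : ℕ) : ℤ))⁻¹
        rw [zpow_negSucc, zpow_natCast] }
  have hA : ∀ x y : G, x + y = x * y * ⁅y, x⁆ ^ (k + 1) := fun _ _ => rfl
  have hZ : (0 : G) = 1 := rfl
  have hS : ∀ (n : ℕ) (x : G), n • x = x ^ n := fun _ _ => rfl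
  let mod : Module (ZMod p) G := AddCommGroup.zmodModule (n := p) hexp
  let B0 : G → G →+ G := fun x => AddMonoidHom.mk' (fun y => ⁅x, y⁆) (by
    intro y z
    rw [hA, hA, hmr, hmr, hcr, hcr1, one_pow])
  let B1 : G →+ (G →ₗ[ZMod p] G) := AddMonoidHom.mk' (fun x => (B0 x).toZModLinearMap p) (by
    intro x y
    ext z
    change ⁅x + y, z⁆ = ⁅x, z⁆ + ⁅y, z⁆
    rw [hA, hA, hml, hml, hcl, hcr1, one_pow])
  have hhalf : (2 : ZMod p)⁻¹ = ((k + 1 : ℕ) : ZMod p) := by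
    have h2 : (2 : ZMod p) * ((k + 1 : ℕ) : ZMod p) = 1 := by
      have : (2 : ZMod p) * ((k + 1 : ℕ) : ZMod p) = ((2 * k + 1 : ℕ) : ZMod p) + 1 := by
        push_cast; ring
      rw [this, ← hk]; simp
    exact inv_eq_of_mul_eq_one_right h2
  refine ⟨G, inst, mod, Equiv.refl G, B1.toZModLinearMap p, ?_, ?_, ?_, ?_⟩
  · intro x
    change ⁅x, x⁆ = 1
    exact commutatorElement_self x
  · intro x y z
    change ⁅⁅x, y⁆, z⁆ = 1
    exact hcl1 x y z
  · intro x y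
    change x * y = x + y + (2 : ZMod p)⁻¹ • ⁅x, y⁆
    rw [hhalf, Nat.cast_smul_eq_nsmul, hS, hA, hcl, one_pow, mul_one, hA, mul_assoc (x * y),
      ← Commute.mul_pow (hc y x _), ← commutatorElement_inv x y, inv_mul_cancel, one_pow, mul_one]
  · intro x y
    rfl

/-! ### Trilinear forms modulo coboundaries -/

/-- The functions `L × L × L → F` that are coboundaries of a normalized `2`-cochain factoring
through `L ⧸ N`. -/
def coboundaries {F L : Type*} [Field F] [AddCommGroup L] [Module F L] (N : Submodule F L) :
    Submodule F (L → L → L → F) where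
  carrier := {T | ∃ γ : L → L → F, (∀ u ∈ N, ∀ x y, γ (x + u) y = γ x y ∧ γ x (y + u) = γ x y) ∧
    (∀ x, γ x 0 = 0 ∧ γ 0 x = 0) ∧
    ∀ x y z, T x y z = γ x (y + z) - γ x y - γ (x + y) z + γ y z}
  zero_mem' := ⟨0, by simp, by simp, by simp⟩
  add_mem' := by
    rintro T T' ⟨γ, h1, h2, h3⟩ ⟨γ', h1', h2', h3'⟩
    refine ⟨γ + γ', ?_, ?_, ?_⟩
    · intro u hu x y
      simp [h1 u hu x y, h1' u hu x y]
    · intro x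
      simp [h2 x, h2' x]
    · intro x y z
      simp only [Pi.add_apply, h3, h3']
      ring
  smul_mem' := by
    rintro c T ⟨γ, h1, h2, h3⟩
    refine ⟨c • γ, ?_, ?_, ?_⟩
    · intro u hu x y
      simp [h1 u hu x y]
    · intro x
      simp [h2 x]
    · intro x y z
      simp only [Pi.smul_apply, smul_eq_mul, h3]
      ring

/-- The trilinear form `f ⊗ g ⊗ h`. -/
def tensorForm {F L : Type*} [Field F] [AddCommGroup L] [Module F L] (f g h : L →ₗ[F] F) :
    L → L → L → F := fun x y z => f x * g y * h z

/-- Up to sign, f ⊗ g + g ⊗ f is the polarization of the quadratic function fg. With the companion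
swap below, this makes trilinear tensors alternating modulo coboundaries. -/
theorem tensorForm_swap_left_mem {F L : Type*} [Field F] [AddCommGroup L] [Module F L]
    {N : Submodule F L} {f g h : L →ₗ[F] F} (hf : N ≤ LinearMap.ker f) (hg : N ≤ LinearMap.ker g)
    (hh : N ≤ LinearMap.ker h) : tensorForm f g h + tensorForm g f h ∈ coboundaries N := by
  refine ⟨fun x y => -(f x * g x * h y), ?_, ?_, ?_⟩
  · intro u hu x y
    simp [LinearMap.mem_ker.mp (hf hu), LinearMap.mem_ker.mp (hg hu), LinearMap.mem_ker.mp (hh hu)]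
  · intro x; simp
  · intro x y z
    simp only [tensorForm, Pi.add_apply, map_add]
    ring

theorem tensorForm_swap_right_mem {F L : Type*} [Field F] [AddCommGroup L] [Module F L]
    {N : Submodule F L} {f g h : L →ₗ[F] F} (hf : N ≤ LinearMap.ker f) (hg : N ≤ LinearMap.ker g)
    (hh : N ≤ LinearMap.ker h) : tensorForm f g h + tensorForm f h g ∈ coboundaries N := by
  refine ⟨fun x y => f x * g y * h y, ?_, ?_, ?_⟩
  · intro u hu x y
    simp [LinearMap.mem_ker.mp (hf hu), LinearMap.mem_ker.mp (hg hu), LinearMap.mem_ker.mp (hh hu)]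
  · intro x; simp
  · intro x y z
    simp only [tensorForm, Pi.add_apply, map_add]
    ring

/-- Averaging over rotations would need division by 3, which fails for p = 3. Instead each triple of
distinct indices is rotated so that its largest index comes last, and whole orbits cancel. -/
theorem sum_eq_zero_of_cyclic {I M : Type*} [Fintype I] [LinearOrder I] [AddCommGroup M]
    (a : I → I → I → M) (h : ∀ i j k, a i j k + a j k i + a k i j = 0)
    (h1 : ∀ i j, a i i j = 0) (h2 : ∀ i j, a i j j = 0) (h3 : ∀ i j, a i j i = 0) :
    ∑ i, ∑ j, ∑ k, a i j k = 0 := by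
  let c : I → I → I → M → M := fun i j k m => if i < k ∧ j < k then m else 0
  have e : ∀ i j k, a i j k = c i j k (a i j k) + c j k i (a i j k) + c k i j (a i j k) := by
    intro i j k
    simp only [c]
    by_cases hij : i = j
    · subst hij; simp [h1]
    by_cases hjk : j = k
    · subst hjk; simp [h2]
    by_cases hik : i = k
    · subst hik; simp [h3]
    rcases lt_or_gt_of_ne hij with hij | hij <;> rcases lt_or_gt_of_ne hjk with hjk | hjk <;>
      rcases lt_or_gt_of_ne hik with hik | hik <;>
      simp [hij, hjk, hik, hij.not_gt, hjk.not_gt, hik.not_gt]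
    · exact absurd (hij.trans hjk) hik.not_gt
    · exact absurd (hjk.trans hij) hik.not_gt
  have e2 : ∑ i, ∑ j, ∑ k, c j k i (a i j k) = ∑ i, ∑ j, ∑ k, c i j k (a k i j) := by
    rw [Finset.sum_comm' (t' := Finset.univ) (s' := fun _ => Finset.univ) (by simp)]
    refine Finset.sum_congr rfl fun i _ => ?_
    rw [Finset.sum_comm]
  have e3 : ∑ i, ∑ j, ∑ k, c k i j (a i j k) = ∑ i, ∑ j, ∑ k, c i j k (a j k i) := by
    rw [Finset.sum_congr rfl (fun i _ => Finset.sum_comm), Finset.sum_comm]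
  calc ∑ i, ∑ j, ∑ k, a i j k
      = ∑ i, ∑ j, ∑ k, (c i j k (a i j k) + c j k i (a i j k) + c k i j (a i j k)) :=
        Finset.sum_congr rfl fun i _ => Finset.sum_congr rfl fun j _ =>
          Finset.sum_congr rfl fun k _ => e i j k
    _ = ∑ i, ∑ j, ∑ k, (c i j k (a i j k) + c i j k (a k i j) + c i j k (a j k i)) := by
        simp only [Finset.sum_add_distrib, e2, e3]
    _ = 0 := by
        refine Finset.sum_eq_zero fun i _ => Finset.sum_eq_zero fun j _ =>
          Finset.sum_eq_zero fun k _ => ?_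
        simp only [c]
        split_ifs
        · rw [← h i j k]; abel
        · simp

/-- Modulo coboundaries the tensors are alternating, hence invariant under rotation, so the cyclic
relation on the coefficients kills the sum. -/
theorem sum_smul_tensorForm_mem {F L I : Type*} [Field F] (htwo : (2 : F) ≠ 0) [AddCommGroup L]
    [Module F L] [Fintype I] [LinearOrder I] {N : Submodule F L} (f : I → L →ₗ[F] F)
    (hf : ∀ i, N ≤ LinearMap.ker (f i)) (c : I → I → I → F)
    (hc : ∀ i j k, c i j k + c j k i + c k i j = 0) :
    ∑ i, ∑ j, ∑ k, c i j k • tensorForm (f i) (f j) (f k) ∈ coboundaries N := by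
  let φ : I → I → I → (L → L → L → F) ⧸ coboundaries N := fun i j k =>
    (coboundaries N).mkQ (tensorForm (f i) (f j) (f k))
  have hl : ∀ i j k, φ i j k = -φ j i k := fun i j k => by
    rw [eq_neg_iff_add_eq_zero]
    exact (Submodule.Quotient.mk_eq_zero _).mpr (tensorForm_swap_left_mem (hf i) (hf j) (hf k))
  have hr : ∀ i j k, φ i j k = -φ i k j := fun i j k => by
    rw [eq_neg_iff_add_eq_zero]
    exact (Submodule.Quotient.mk_eq_zero _).mpr (tensorForm_swap_right_mem (hf i) (hf j) (hf k))
  have hself : ∀ v : (L → L → L → F) ⧸ coboundaries N, v = -v → v = 0 := by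
    intro v hv
    have : (2 : F) • v = 0 := by rw [two_smul]; nth_rewrite 1 [hv]; exact neg_add_cancel v
    exact (smul_eq_zero.mp this).resolve_left htwo
  have hcyc : ∀ i j k, φ j k i = φ i j k := fun i j k => by
    rw [hr j k i, hl j i k, neg_neg]
  have h1 : ∀ i j, φ i i j = 0 := fun i j => hself _ (hl i i j)
  rw [← Submodule.Quotient.mk_eq_zero, ← Submodule.mkQ_apply]
  simp only [map_sum, map_smul]
  refine sum_eq_zero_of_cyclic (fun i j k => c i j k • φ i j k) ?_ ?_ ?_ ?_
  · intro i j k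
    rw [hcyc i j k, ← hcyc k i j, ← add_smul, ← add_smul, hc, zero_smul]
  · intro i j; simp only [h1, smul_zero]
  · intro i j; rw [← hcyc i j j, h1, smul_zero]
  · intro i j; rw [hcyc i i j, h1, smul_zero]

/-- The form `(x, y, z) ↦ τ (B x y) z` is a coboundary modulo the span of the brackets. -/
theorem jacobi_mem_coboundaries {F L : Type*} [Field F] (htwo : (2 : F) ≠ 0) [AddCommGroup L]
    [Module F L] [FiniteDimensional F L] (B : L →ₗ[F] L →ₗ[F] L) (hB : ∀ x, B x x = 0)
    (N : Submodule F L) (hBN : ∀ x ∈ N, ∀ y, B x y = 0) (τ : L →ₗ[F] L →ₗ[F] F)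
    (hτN : ∀ x, ∀ y ∈ N, τ x y = 0)
    (hτ : ∀ a b c, τ (B a b) c + τ (B b c) a + τ (B c a) b = 0) :
    (fun x y z => τ (B x y) z) ∈ coboundaries N := by
  have hanti : ∀ x y, B x y = -B y x := by
    intro x y
    have := hB (x + y)
    simp only [map_add, LinearMap.add_apply, hB, zero_add, add_zero] at this
    exact eq_neg_of_add_eq_zero_right this
  -- A projection with kernel `N` gives coordinate functionals that vanish on `N`, so the resulting
  -- cochain factors through L/N.
  obtain ⟨π, hπ⟩ : ∃ π : L →ₗ[F] L, (∀ u ∈ N, π u = 0) ∧ ∀ x, π x - x ∈ N := by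
    obtain ⟨s, hs⟩ := N.subtype.exists_leftInverse_of_injective N.ker_subtype
    refine ⟨LinearMap.id - N.subtype ∘ₗ s, ?_, ?_⟩
    · intro u hu
      have := LinearMap.congr_fun hs ⟨u, hu⟩
      simp only [LinearMap.comp_apply, LinearMap.id_apply, Submodule.subtype_apply] at this
      simp [this]
    · intro x
      simp
  let b := Module.finBasis F L
  let f := fun i => b.coord i ∘ₗ π
  have hf : ∀ i, N ≤ LinearMap.ker (f i) := by
    intro i u hu
    simp [f, hπ.1 u hu]
  have key := sum_smul_tensorForm_mem htwo f hf (fun i j k => τ (B (b i) (b j)) (b k))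
    (fun i j k => hτ _ _ _)
  convert key using 1
  funext x y z
  have hpi : ∀ x, π x = ∑ i, f i x • b i := fun x => (b.sum_repr (π x)).symm
  have hx : B x y = B (π x) (π y) := by
    have h1 : B (π x) = B x := by
      rw [← sub_eq_zero, ← map_sub]
      ext y; rw [hBN _ (hπ.2 x)]; rfl
    have h2 : B x (π y) = B x y := by
      rw [← sub_eq_zero, ← map_sub, hanti, hBN _ (hπ.2 y), neg_zero]
    rw [h1, h2]
  have hz : ∀ u, τ u z = τ u (π z) := by
    intro u
    rw [eq_comm, ← sub_eq_zero, ← map_sub, hτN _ _ (hπ.2 z)]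
  rw [hx, hz, hpi x, hpi y, hpi z]
  simp only [map_sum, LinearMap.sum_apply, map_smul, LinearMap.smul_apply, Finset.sum_apply,
    Pi.smul_apply, smul_eq_mul, tensorForm, Finset.mul_sum]
  rw [Finset.sum_congr rfl (fun k _ => Finset.sum_comm), Finset.sum_comm]
  refine Finset.sum_congr rfl fun i _ => ?_
  rw [Finset.sum_comm]
  refine Finset.sum_congr rfl fun j _ => Finset.sum_congr rfl fun k _ => ?_
  ring

/-! ### Central extensions from cocycles -/

/-- A (not necessarily normalized) `2`-cocycle of `G` with trivial coefficients in `A`. -/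
structure TrivialCocycle (G A : Type*) [Group G] [AddCommGroup A] where
  toFun : G → G → A
  cocycle : ∀ x y z, toFun x y + toFun (x * y) z = toFun y z + toFun x (y * z)

/-- The central extension of `G` by `A` defined by a `2`-cocycle. -/
@[ext] structure CocycleExtension {G A : Type*} [Group G] [AddCommGroup A]
    (c : TrivialCocycle G A) where
  base : G
  fiber : A

namespace CocycleExtension

variable {G A : Type*} [Group G] [AddCommGroup A] (c : TrivialCocycle G A)

theorem cocycle_one_left (x : G) : c.toFun 1 x = c.toFun 1 1 := by
  have := c.cocycle 1 1 x
  simp only [one_mul] at this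
  exact (add_right_cancel this).symm

theorem cocycle_one_right (x : G) : c.toFun x 1 = c.toFun 1 1 := by
  have := c.cocycle x 1 1
  simp only [mul_one] at this
  exact add_right_cancel this

instance : Mul (CocycleExtension c) :=
  ⟨fun x y => ⟨x.base * y.base, x.fiber + y.fiber + c.toFun x.base y.base⟩⟩

instance : One (CocycleExtension c) := ⟨⟨1, -c.toFun 1 1⟩⟩

instance : Inv (CocycleExtension c) :=
  ⟨fun x => ⟨x.base⁻¹, -x.fiber - c.toFun x.base⁻¹ x.base - c.toFun 1 1⟩⟩

theorem mul_def (x y : CocycleExtension c) :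
    x * y = ⟨x.base * y.base, x.fiber + y.fiber + c.toFun x.base y.base⟩ := rfl

theorem one_def : (1 : CocycleExtension c) = ⟨1, -c.toFun 1 1⟩ := rfl

theorem inv_def (x : CocycleExtension c) :
    x⁻¹ = ⟨x.base⁻¹, -x.fiber - c.toFun x.base⁻¹ x.base - c.toFun 1 1⟩ := rfl

instance : Group (CocycleExtension c) := Group.ofLeftAxioms
  (fun x y z => by
    ext
    · simp [mul_def, mul_assoc]
    · have := c.cocycle x.base y.base z.base
      simp only [mul_def]
      rw [show x.fiber + y.fiber + c.toFun x.base y.base + z.fiber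
        + c.toFun (x.base * y.base) z.base = x.fiber + y.fiber + z.fiber + (c.toFun x.base y.base
        + c.toFun (x.base * y.base) z.base) by abel, this]
      abel)
  (fun x => by
    ext
    · simp [mul_def, one_def]
    · simp [mul_def, one_def, cocycle_one_left])
  (fun x => by
    ext
    · simp [mul_def, one_def, inv_def]
    · simp only [mul_def, one_def, inv_def]; abel)

/-- The projection of a central extension onto its base. -/
def proj : CocycleExtension c →* G where
  toFun := base
  map_one' := rfl
  map_mul' _ _ := rfl

theorem proj_surjective : Function.Surjective (proj c) := fun g => ⟨⟨g, 0⟩, rfl⟩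

end CocycleExtension

/-- One cocycle per group element is collected into a single cocycle with values in `G → ZMod p`. In
its extension no nontrivial central element of `G` lifts to a central element, so the centre is
exactly the kernel of the projection. -/
theorem isCapable_of_cocycles.{u} {G : Type u} [Group G] (p : ℕ)
    (h : ∀ z ∈ Subgroup.center G, z ≠ 1 →
      ∃ c : TrivialCocycle G (ZMod p), ∃ x, c.toFun z x ≠ c.toFun x z) : IsCapable G := by
  have h' : ∀ z : G, ∃ c : TrivialCocycle G (ZMod p), z ∈ Subgroup.center G → z ≠ 1 →
      ∃ x, c.toFun z x ≠ c.toFun x z := by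
    intro z
    by_cases hz : z ∈ Subgroup.center G ∧ z ≠ 1
    · obtain ⟨c, hc⟩ := h z hz.1 hz.2
      exact ⟨c, fun _ _ => hc⟩
    · exact ⟨⟨fun _ _ => 0, by simp⟩, fun h1 h2 => absurd ⟨h1, h2⟩ hz⟩
  choose d hd using h'
  let c : TrivialCocycle G (G → ZMod p) :=
    ⟨fun x y z => (d z).toFun x y, fun x y w => funext fun z => (d z).cocycle x y w⟩
  have hker : (CocycleExtension.proj c).ker = Subgroup.center (CocycleExtension c) := by
    ext x
    rw [MonoidHom.mem_ker, Subgroup.mem_center_iff]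
    constructor
    · intro hx y
      have hx' : x.base = 1 := hx
      ext1
      · simp [CocycleExtension.mul_def, hx']
      · simp only [CocycleExtension.mul_def, hx', CocycleExtension.cocycle_one_left,
          CocycleExtension.cocycle_one_right]
        abel
    · intro hx
      by_contra hne
      have hcen : x.base ∈ Subgroup.center G := by
        rw [Subgroup.mem_center_iff]
        intro g
        exact congrArg CocycleExtension.base (hx ⟨g, 0⟩)
      obtain ⟨g, hg⟩ := hd x.base hcen hne
      apply hg
      have := congrFun (congrArg CocycleExtension.fiber (hx ⟨g, 0⟩)) x.base
      simp only [CocycleExtension.mul_def, Pi.add_apply, zero_add, add_zero] at this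
      exact (add_left_cancel this).symm
  exact ⟨CocycleExtension c, inferInstance,
    ⟨(QuotientGroup.quotientKerEquivOfSurjective _ (CocycleExtension.proj_surjective c)).symm.trans
      (QuotientGroup.quotientMulEquivOfEq hker)⟩⟩

/-! ### From Jacobi forms to capability -/

/-- The span of all values of a bilinear bracket. -/
def bracketSpan {F L : Type*} [Field F] [AddCommGroup L] [Module F L] (B : L →ₗ[F] L →ₗ[F] L) :
    Submodule F L := Submodule.span F {w | ∃ x y, B x y = w}

theorem bracket_mem_bracketSpan {F L : Type*} [Field F] [AddCommGroup L] [Module F L]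
    (B : L →ₗ[F] L →ₗ[F] L) (x y : L) : B x y ∈ bracketSpan B :=
  Submodule.subset_span ⟨x, y, rfl⟩

/-- A bilinear bracket with values restricted to their span. -/
def bracketToSpan {F L : Type*} [Field F] [AddCommGroup L] [Module F L]
    (B : L →ₗ[F] L →ₗ[F] L) : L →ₗ[F] L →ₗ[F] bracketSpan B :=
  LinearMap.mk₂ F (fun x y => ⟨B x y, bracket_mem_bracketSpan B x y⟩)
    (by intro x x' y; ext; simp) (by intro c x y; ext; simp)
    (by intro x y y'; ext; simp) (by intro c x y; ext; simp)

theorem bracket_eq_zero_of_mem_bracketSpan {F L : Type*} [Field F] [AddCommGroup L] [Module F L]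
    {B : L →ₗ[F] L →ₗ[F] L} (hBB : ∀ x y z, B (B x y) z = 0) {u : L} (hu : u ∈ bracketSpan B)
    (y : L) : B u y = 0 := by
  have : bracketSpan B ≤ LinearMap.ker B := by
    refine Submodule.span_le.mpr ?_
    rintro _ ⟨a, b, rfl⟩
    exact LinearMap.ext (hBB a b)
  rw [LinearMap.mem_ker.mp (this hu)]; rfl

/-- A class two Lie algebra whose Jacobi forms separate the points of the derived algebra comes
from a capable group. -/
theorem isCapable_of_jacobi.{u} {p : ℕ} [Fact p.Prime] (hodd : Odd p) {G L : Type u} [Group G]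
    [AddCommGroup L] [Module (ZMod p) L] [FiniteDimensional (ZMod p) L] (e : G ≃ L)
    (B : L →ₗ[ZMod p] L →ₗ[ZMod p] L) (hB : ∀ x, B x x = 0) (hBB : ∀ x y z, B (B x y) z = 0)
    (he : ∀ x y, e (x * y) = e x + e y + (2 : ZMod p)⁻¹ • B (e x) (e y)) (hne : B ≠ 0)
    (hJ : ∀ w : bracketSpan B, w ≠ 0 → ∃ t : bracketSpan B →ₗ[ZMod p] L →ₗ[ZMod p] ZMod p,
      (∀ a b c, t (bracketToSpan B a b) c + t (bracketToSpan B b c) a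
        + t (bracketToSpan B c a) b = 0) ∧ t w ≠ 0) : IsCapable G := by
  have htwo : (2 : ZMod p) ≠ 0 := by
    intro h
    have h2 : p ∣ 2 := (ZMod.natCast_eq_zero_iff 2 p).mp (by exact_mod_cast h)
    rcases (Nat.dvd_prime Nat.prime_two).mp h2 with rfl | rfl
    · exact Nat.not_prime_one Fact.out
    · exact absurd hodd (by decide)
  have hanti : ∀ x y, B x y = -B y x := by
    intro x y
    have := hB (x + y)
    simp only [map_add, LinearMap.add_apply, hB, zero_add, add_zero] at this
    exact eq_neg_of_add_eq_zero_right this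
  have he1 : e 1 = 0 := by
    have := he 1 1
    rw [hB, smul_zero, add_zero, mul_one] at this
    exact left_eq_add.mp this
  refine isCapable_of_cocycles p fun z hz hz1 => ?_
  have hez : e z ≠ 0 := fun h => hz1 (e.injective (h.trans he1.symm))
  have hzB : B (e z) = 0 := by
    ext y
    have h1 := congrArg e (Subgroup.mem_center_iff.mp hz (e.symm y))
    rw [he, he, e.apply_symm_apply, add_comm y (e z)] at h1
    have h2 := smul_right_injective L (inv_ne_zero htwo) (add_left_cancel h1)
    have h3 : (2 : ZMod p) • B (e z) y = 0 := by
      rw [two_smul]; nth_rewrite 1 [← h2]; rw [hanti y]; exact neg_add_cancel _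
    exact (smul_eq_zero.mp h3).resolve_left htwo
  by_cases hzW : e z ∈ bracketSpan B
  · obtain ⟨t, ht, htz⟩ := hJ ⟨e z, hzW⟩ (fun h => hez (congrArg Subtype.val h))
    obtain ⟨s, hs⟩ := (bracketSpan B).subtype.exists_leftInverse_of_injective
      (bracketSpan B).ker_subtype
    have hs' : ∀ u (hu : u ∈ bracketSpan B), s u = ⟨u, hu⟩ :=
      fun u hu => LinearMap.congr_fun hs ⟨u, hu⟩
    let τ := t ∘ₗ s
    have hτB : ∀ a b, τ (B a b) = t (bracketToSpan B a b) := fun a b => by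
      simp only [τ, LinearMap.comp_apply, hs' _ (bracket_mem_bracketSpan B a b)]; rfl
    -- If y is a sum of brackets, the Jacobi identity for (a, b, y) loses its other two terms.
    have htW : ∀ w : bracketSpan B, ∀ y ∈ bracketSpan B, t w y = 0 := by
      intro w y hy
      have h1 : ∀ a b, t (bracketToSpan B a b) y = 0 := by
        intro a b
        have h2 : bracketToSpan B y a = 0 :=
          Subtype.ext (bracket_eq_zero_of_mem_bracketSpan hBB hy a)
        have h3 : bracketToSpan B b y = 0 := Subtype.ext (by
          change B b y = 0
          rw [hanti, bracket_eq_zero_of_mem_bracketSpan hBB hy, neg_zero])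
        have := ht a b y
        rwa [h2, h3, map_zero, LinearMap.zero_apply, LinearMap.zero_apply, add_zero,
          add_zero] at this
      have h4 : bracketSpan B ≤ LinearMap.ker (τ.flip y) := by
        refine Submodule.span_le.mpr ?_
        rintro _ ⟨a, b, rfl⟩
        change τ (B a b) y = 0
        rw [hτB, h1]
      have h5 : τ w.1 y = 0 := h4 w.2
      simpa only [τ, LinearMap.comp_apply, hs' _ w.2] using h5
    have hτW : ∀ x, ∀ y ∈ bracketSpan B, τ x y = 0 := fun x y hy => htW _ y hy
    have hmem := jacobi_mem_coboundaries htwo B hB (bracketSpan B)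
      (fun x hx y => bracket_eq_zero_of_mem_bracketSpan hBB hx y) τ hτW
      (fun a b c => by rw [hτB, hτB, hτB]; exact ht a b c)
    -- On `G` the bilinear τ misses the cocycle identity by ½τ(B(x,y),z), coming from the Baer
    -- product. This defect is the coboundary of γ, so τ + γ is a cocycle.
    obtain ⟨γ, hγ1, hγ2, hγ3⟩ := (coboundaries (bracketSpan B)).smul_mem (2 : ZMod p)⁻¹ hmem
    have hmemW : ∀ x y, (2 : ZMod p)⁻¹ • B x y ∈ bracketSpan B := fun x y =>
      Submodule.smul_mem _ _ (bracket_mem_bracketSpan B x y)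
    refine ⟨⟨fun x y => τ (e x) (e y) + γ (e x) (e y), ?_⟩, ?_⟩
    · intro x y w
      rw [he, he, (hγ1 _ (hmemW (e x) (e y)) (e x + e y) (e w)).1,
        (hγ1 _ (hmemW (e y) (e w)) (e x) (e y + e w)).2]
      have h1 := hγ3 (e x) (e y) (e w)
      simp only [Pi.smul_apply, smul_eq_mul] at h1
      simp only [map_add, LinearMap.add_apply, map_smul, LinearMap.smul_apply, smul_eq_mul,
        hτW _ _ (bracket_mem_bracketSpan B _ _)]
      rw [h1]; ring
    · by_contra! hcon
      apply htz
      ext y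
      have := hcon (e.symm y)
      have h0 : ∀ x, γ (e z) x = 0 ∧ γ x (e z) = 0 := by
        intro x
        have h1 := hγ1 _ hzW 0 x
        have h2 := hγ1 _ hzW x 0
        rw [zero_add] at h1 h2
        exact ⟨h1.1.trans (hγ2 x).2, h2.2.trans (hγ2 x).1⟩
      simp only [e.apply_symm_apply, (h0 y).1, (h0 y).2, hτW y _ hzW, add_zero] at this
      simp only [τ, LinearMap.comp_apply, hs' _ hzW] at this
      exact this
  -- A central element outside the bracket span is detected by λ ⊗ μ, with λ and μ killing brackets,
  -- λ(z) ≠ 0, μ(z) = 0 and μ ≠ 0. Such a μ exists because `B ≠ 0`.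
  · obtain ⟨lam, hlz, hlW⟩ := Submodule.exists_le_ker_of_notMem hzW
    have hlt : bracketSpan B ⊔ Submodule.span (ZMod p) {e z} < ⊤ := by
      refine lt_top_iff_ne_top.mpr fun htop => hne ?_
      have : bracketSpan B ⊔ Submodule.span (ZMod p) {e z} ≤ LinearMap.ker B := by
        refine sup_le (fun u hu => ?_) ?_
        · exact LinearMap.ext (bracket_eq_zero_of_mem_bracketSpan hBB hu)
        · rw [Submodule.span_singleton_le_iff_mem]; exact hzB
      rw [htop, top_le_iff] at this
      exact LinearMap.ker_eq_top.mp this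
    obtain ⟨μ, hμ, hle⟩ := Submodule.exists_le_ker_of_lt_top _ hlt
    have hadd : ∀ f : L →ₗ[ZMod p] ZMod p, bracketSpan B ≤ LinearMap.ker f →
        ∀ x y, f (e (x * y)) = f (e x) + f (e y) := by
      intro f hf x y
      rw [he, map_add, map_add, map_smul,
        LinearMap.mem_ker.mp (hf (bracket_mem_bracketSpan B _ _)), smul_zero, add_zero]
    refine ⟨⟨fun x y => lam (e x) * μ (e y), ?_⟩, ?_⟩
    · intro x y w
      simp only [hadd lam hlW, hadd μ (le_sup_left.trans hle)]
      ring
    · by_contra! hcon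
      apply hμ
      ext y
      have h1 := hcon (e.symm y)
      have h2 : μ (e z) = 0 := hle (Submodule.mem_sup_right (Submodule.mem_span_singleton_self _))
      simp only [e.apply_symm_apply, h2, mul_zero] at h1
      exact (mul_eq_zero.mp h1).resolve_left hlz

/-! ### From capability to Jacobi forms -/

section

open scoped commutatorElement IsMulCommutative

theorem commutatorElement_mul_right_of_mem_center {K : Type*} [Group K] {k : K}
    (hk : ∀ l, ⁅k, l⁆ ∈ Subgroup.center K) (l l' : K) : ⁅k, l * l'⁆ = ⁅k, l⁆ * ⁅k, l'⁆ := by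
  have h := Subgroup.mem_center_iff.mp (hk l') l
  have e : ⁅k, l * l'⁆ = ⁅k, l⁆ * (l * ⁅k, l'⁆ * l⁻¹) := by
    simp only [commutatorElement_def]; group
  rw [e, h, mul_inv_cancel_right]

theorem commutatorElement_mul_left_of_mem_center {K : Type*} [Group K] {k' : K}
    (hk : ∀ l, ⁅k', l⁆ ∈ Subgroup.center K) (k l : K) : ⁅k * k', l⁆ = ⁅k, l⁆ * ⁅k', l⁆ := by
  have h := Subgroup.mem_center_iff.mp (hk l)
  have e : ⁅k * k', l⁆ = k * ⁅k', l⁆ * k⁻¹ * ⁅k, l⁆ := by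
    simp only [commutatorElement_def]; group
  rw [e, h k, mul_inv_cancel_right, ← h]

theorem commutatorElement_eq_of_div_mem_center {K : Type*} [Group K] {k k' l l' : K}
    (hk : k'⁻¹ * k ∈ Subgroup.center K) (hl : l'⁻¹ * l ∈ Subgroup.center K) :
    ⁅k, l⁆ = ⁅k', l'⁆ := by
  obtain ⟨z, rfl⟩ : ∃ z, k = k' * z := ⟨k'⁻¹ * k, by group⟩
  obtain ⟨u, rfl⟩ : ∃ u, l = l' * u := ⟨l'⁻¹ * l, by group⟩
  rw [inv_mul_cancel_left] at hk hl
  have hz : ∀ x : K, ⁅z, x⁆ = 1 := fun x =>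
    commutatorElement_eq_one_iff_mul_comm.mpr (Subgroup.mem_center_iff.mp hk x).symm
  have hu : ∀ x : K, ⁅x, u⁆ = 1 := fun x =>
    commutatorElement_eq_one_iff_mul_comm.mpr (Subgroup.mem_center_iff.mp hl x)
  rw [commutatorElement_mul_left_of_mem_center (fun x => by rw [hz]; exact one_mem _), hz, mul_one]
  have e : ⁅k', l' * u⁆ = ⁅k', l'⁆ * (l' * ⁅k', u⁆ * l'⁻¹) := by
    simp only [commutatorElement_def]; group
  rw [e, hu]; group

/-- The commutator with an element whose commutators are all central. -/
def commutatorHom {K : Type*} [Group K] (k : K) (hk : ∀ l, ⁅k, l⁆ ∈ Subgroup.center K) :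
    K →* Subgroup.center K where
  toFun l := ⟨⁅k, l⁆, hk l⟩
  map_one' := Subtype.ext (commutatorElement_one_right k)
  map_mul' l l' := Subtype.ext (commutatorElement_mul_right_of_mem_center hk l l')

/-- A lift of w ∈ W to K is central modulo Z(K), so its commutators lie in Z(K) and depend only on
images in `G`. They form a bilinear map on W × L that is nonzero at w, since the lift of w is not
central. -/
theorem exists_jacobi_of_isCapable.{u} {p : ℕ} [Fact p.Prime] {G L : Type u} [Group G]
    (hexp : ∀ g : G, g ^ p = 1) (hcap : IsCapable G)
    [AddCommGroup L] [Module (ZMod p) L] (e : G ≃ L)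
    (B : L →ₗ[ZMod p] L →ₗ[ZMod p] L) (hB : ∀ x, B x x = 0) (hBB : ∀ x y z, B (B x y) z = 0)
    (he : ∀ x y, e (x * y) = e x + e y + (2 : ZMod p)⁻¹ • B (e x) (e y))
    (heB : ∀ x y, e ⁅x, y⁆ = B (e x) (e y))
    (w : bracketSpan B) (hw : w ≠ 0) :
    ∃ t : bracketSpan B →ₗ[ZMod p] L →ₗ[ZMod p] ZMod p,
      (∀ a b c, t (bracketToSpan B a b) c + t (bracketToSpan B b c) a
        + t (bracketToSpan B c a) b = 0) ∧ t w ≠ 0 := by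
  obtain ⟨K, _, ⟨f⟩⟩ := hcap
  let q : K →* G := f.symm.toMonoidHom.comp (QuotientGroup.mk' (Subgroup.center K))
  have hq : ∀ k, q k = 1 ↔ k ∈ Subgroup.center K := by
    intro k
    simp only [q, MonoidHom.comp_apply, MulEquiv.toMonoidHom_eq_coe, MonoidHom.coe_coe,
      EmbeddingLike.map_eq_one_iff]
    exact QuotientGroup.eq_one_iff k
  have hqs : Function.Surjective q :=
    f.symm.surjective.comp (QuotientGroup.mk'_surjective _)
  have hqe : ∀ k k' l l', q k = q k' → q l = q l' → ⁅k, l⁆ = ⁅k', l'⁆ := by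
    intro k k' l l' h h'
    refine commutatorElement_eq_of_div_mem_center ?_ ?_
    · rw [← hq, map_mul, map_inv, h, inv_mul_cancel]
    · rw [← hq, map_mul, map_inv, h', inv_mul_cancel]
  have he1 : e 1 = 0 := by
    have := he 1 1
    rw [hB, smul_zero, add_zero, mul_one] at this
    exact left_eq_add.mp this
  choose s hs using fun x : L => hqs (e.symm x)
  have hcen : ∀ k, e (q k) ∈ bracketSpan B → ∀ l, ⁅k, l⁆ ∈ Subgroup.center K := by
    intro k hk l
    rw [← hq, map_commutatorElement]
    apply e.injective
    rw [heB, he1, bracket_eq_zero_of_mem_bracketSpan hBB hk]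
  have hsW : ∀ w ∈ bracketSpan B, e (q (s w)) ∈ bracketSpan B := fun w hw => by
    rw [hs, e.apply_symm_apply]; exact hw
  let h : bracketSpan B → K →* Subgroup.center K := fun w =>
    commutatorHom (s w) (hcen _ (hsW w.1 w.2))
  have hval : ∀ (w : bracketSpan B) (l : K), ((h w l : Subgroup.center K) : K) = ⁅s w, l⁆ :=
    fun _ _ => rfl
  have hcong : ∀ (w : bracketSpan B) (l l' : K), q l = q l' → h w l = h w l' := fun w l l' hl =>
    Subtype.ext (hqe _ _ _ _ rfl hl)
  have hkill : ∀ (w : bracketSpan B) (a b : K), h w ⁅a, b⁆ = 1 := fun w a b => by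
    rw [map_commutatorElement, commutatorElement_eq_one_iff_commute]
    exact Commute.all _ _
  -- In `G`, Baer addition is the product corrected by the commutator [−x/2, y], which is invisible
  -- to a homomorphism into an abelian group.
  have hadd : ∀ (w : bracketSpan B) (x y : L), h w (s (x + y)) = h w (s x) * h w (s y) := by
    intro w x y
    have : q (s (x + y)) = q (s x * s y * ⁅s (-(2 : ZMod p)⁻¹ • x), s y⁆) := by
      rw [map_mul, map_mul, map_commutatorElement, hs, hs, hs, hs]
      apply e.injective
      rw [he, he, heB, e.apply_symm_apply, e.apply_symm_apply, e.apply_symm_apply,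
        e.apply_symm_apply]
      have hz : ∀ u a b, B u (B a b) = 0 := by
        intro u a b
        have := hB (u + B a b)
        simpa only [map_add, LinearMap.add_apply, hB, hBB, zero_add, add_zero] using this
      rw [hz, smul_zero, add_zero, map_smul, LinearMap.smul_apply, neg_smul,
        add_neg_cancel_right]
    rw [hcong w _ _ this, map_mul, map_mul, hkill, mul_one]
  have hleft : ∀ (w w' : bracketSpan B) (l : K), h (w + w') l = h w l * h w' l := by
    intro w w' l
    apply Subtype.ext
    rw [Subgroup.coe_mul, hval, hval, hval,
      ← commutatorElement_mul_left_of_mem_center (hcen _ (hsW w'.1 w'.2))]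
    refine hqe _ _ _ _ ?_ rfl
    rw [map_mul, hs, hs, hs]
    apply e.injective
    rw [he, e.apply_symm_apply, e.apply_symm_apply, e.apply_symm_apply,
      bracket_eq_zero_of_mem_bracketSpan hBB w.2, smul_zero, add_zero]
    rfl
  have hpow : ∀ (w : bracketSpan B) (l : K), h w l ^ p = 1 := by
    intro w l
    rw [← map_pow, hcong w _ 1 (by rw [map_pow, hexp, map_one]), map_one]
  -- The values have order dividing p, so they lie in the p-torsion of Z(K), an 𝔽_p-space.
  let U := AddSubgroup.torsionBy (Additive (Subgroup.center K)) p
  let _ : Module (ZMod p) U := AddSubgroup.torsionBy.zmodModule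
  let g : bracketSpan B → L → U := fun w x => ⟨Additive.ofMul (h w (s x)), by
    rw [AddSubgroup.torsionBy.nsmul_iff, ← ofMul_pow, hpow]; rfl⟩
  have hg : ∀ w x, ((g w x).1.toMul : K) = ⁅s w, s x⁆ := fun _ _ => rfl
  let T : bracketSpan B →ₗ[ZMod p] L →ₗ[ZMod p] U := AddMonoidHom.toZModLinearMap p
    (AddMonoidHom.mk' (fun w => (AddMonoidHom.mk' (g w) (fun x y =>
      Subtype.ext (hadd w x y))).toZModLinearMap p)
      (fun w w' => LinearMap.ext fun x => Subtype.ext (hleft w w' (s x))))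
  have hT : ∀ w x, T w x = g w x := fun _ _ => rfl
  have hJ : ∀ a b c, T (bracketToSpan B a b) c + T (bracketToSpan B b c) a
      + T (bracketToSpan B c a) b = 0 := by
    intro a b c
    -- Conjugating the right entry does not change these commutators, and puts them in the shape of
    -- the Hall–Witt identity.
    have hred : ∀ a b c, ⁅s (bracketToSpan B a b), s c⁆ = ⁅⁅s a, s b⁆, s b * s c * (s b)⁻¹⁆ := by
      intro a b c
      have h1 : q (s (bracketToSpan B a b)) = q ⁅s a, s b⁆ := by
        rw [map_commutatorElement, hs, hs, hs]
        apply e.injective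
        rw [heB, e.apply_symm_apply, e.apply_symm_apply, e.apply_symm_apply]
        rfl
      rw [← hqe _ _ _ _ h1 rfl, ← hval, ← hval, map_mul, map_mul, map_inv,
        mul_comm (h _ (s b)), mul_inv_cancel_right]
    apply Subtype.ext
    apply Additive.toMul.injective
    apply Subtype.ext
    change ⁅s (bracketToSpan B a b), s c⁆ * ⁅s (bracketToSpan B b c), s a⁆
      * ⁅s (bracketToSpan B c a), s b⁆ = 1
    rw [hred, hred, hred]
    exact commutatorElement_commutatorElement_conj_mul _ _ _
  obtain ⟨x, hx⟩ : ∃ x, T w x ≠ 0 := by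
    by_contra! hcon
    apply hw
    have hc : s w ∈ Subgroup.center K := by
      rw [Subgroup.mem_center_iff]
      intro l
      have h1 := congrArg (fun u : U => (u.1.toMul : K)) (hcon (e (q l)))
      change ⁅s w, s (e (q l))⁆ = 1 at h1
      rw [hqe _ (s w) _ l rfl (by rw [hs, e.symm_apply_apply])] at h1
      exact (commutatorElement_eq_one_iff_mul_comm.mp h1).symm
    rw [← hq, hs] at hc
    apply Subtype.ext
    rw [← e.apply_symm_apply w.1, hc, he1]; rfl
  obtain ⟨ψ, hψ⟩ : ∃ ψ : Module.Dual (ZMod p) U, ψ (T w x) ≠ 0 := by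
    by_contra! hcon
    exact hx ((Module.forall_dual_apply_eq_zero_iff (ZMod p) _).mp hcon)
  refine ⟨T.compr₂ ψ, ?_, ?_⟩
  · intro a b c
    simp only [LinearMap.compr₂_apply]
    rw [← map_add, ← map_add, hJ, map_zero]
  · intro h0
    apply hψ
    rw [← LinearMap.compr₂_apply, h0]; rfl

end

/-! ### Ranks as dimensions, and the conclusion -/

theorem card_eq_pow_rank {A : Type*} [Group A] [Finite A] {p : ℕ} [hp : Fact p.Prime]
    (hcomm : ∀ a b : A, a * b = b * a) (hexp : ∀ a : A, a ^ p = 1) :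
    Nat.card A = p ^ Group.rank A := by
  let _ : CommGroup A := { ‹Group A› with mul_comm := hcomm }
  let _ : Module (ZMod p) (Additive A) := AddCommGroup.zmodModule (n := p) hexp
  have hcard : Nat.card A = p ^ Module.finrank (ZMod p) (Additive A) := by
    have h := Module.natCard_eq_pow_finrank (K := ZMod p) (V := Additive A)
    rwa [Nat.card_zmod] at h
  rw [hcard]
  congr 1
  refine le_antisymm ?_ ?_
  · have h := card_dvd_exponent_pow_rank' A hexp
    rw [hcard] at h
    exact (Nat.pow_dvd_pow_iff_le_right hp.out.one_lt).mp h
  · classical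
    let b := Module.finBasis (ZMod p) (Additive A)
    let S : Finset A := Finset.univ.image fun i => (b i).toMul
    have hS : Subgroup.closure (S : Set A) = ⊤ := by
      have h : AddSubgroup.toZModSubmodule p (Subgroup.toAddSubgroup (Subgroup.closure (S : Set A)))
          = ⊤ := by
        rw [eq_top_iff, ← b.span_eq, Submodule.span_le]
        rintro _ ⟨i, rfl⟩
        have hi : (b i).toMul ∈ (S : Set A) :=
          Finset.mem_coe.mpr (Finset.mem_image_of_mem _ (Finset.mem_univ i))
        have hi' := Subgroup.subset_closure hi
        exact hi'
      refine (Subgroup.eq_top_iff' _).mpr fun x => ?_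
      have hx : Additive.ofMul x ∈ AddSubgroup.toZModSubmodule p
          (Subgroup.toAddSubgroup (Subgroup.closure (S : Set A))) := by rw [h]; trivial
      exact hx
    refine (Group.rank_le hS).trans (Finset.card_image_le.trans ?_)
    simp

theorem exists_coordinates {F L : Type*} [Field F] [AddCommGroup L] [Module F L]
    [FiniteDimensional F L] (N : Submodule F L) {n : ℕ}
    (hn : n + Module.finrank F N = Module.finrank F L) :
    ∃ (b : Fin n → L) (ρ : L →ₗ[F] (Fin n → F)), Function.Surjective ρ ∧
      ∀ x, x - ∑ i, ρ x i • b i ∈ N := by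
  have h := N.finrank_quotient_add_finrank
  let e := Module.finBasisOfFinrankEq F (L ⧸ N) (n := n) (by omega)
  choose b hb using fun i => N.mkQ_surjective (e i)
  refine ⟨b, e.equivFun.toLinearMap ∘ₗ N.mkQ,
    e.equivFun.surjective.comp N.mkQ_surjective, fun x => ?_⟩
  rw [← Submodule.Quotient.mk_eq_zero, ← Submodule.mkQ_apply, map_sub, map_sum, sub_eq_zero]
  simp only [map_smul, hb]
  exact (e.sum_equivFun _).symm

/-- The numerical condition gives enough Jacobi forms. -/
theorem exists_jacobi_bracketSpan {F L : Type*} [Field F] [AddCommGroup L] [Module F L]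
    [FiniteDimensional F L] (B : L →ₗ[F] L →ₗ[F] L) (hB : ∀ x, B x x = 0) {n : ℕ}
    (hn : n + Module.finrank F (LinearMap.ker B) = Module.finrank F L)
    (hf : overlapBound (n.choose 2 - Module.finrank F (bracketSpan B) + 1) < n)
    (w : bracketSpan B) (hw : w ≠ 0) :
    ∃ t : bracketSpan B →ₗ[F] L →ₗ[F] F,
      (∀ a b c, t (bracketToSpan B a b) c + t (bracketToSpan B b c) a
        + t (bracketToSpan B c a) b = 0) ∧ t w ≠ 0 := by
  have hanti : ∀ x y, B x y = -B y x := by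
    intro x y
    have := hB (x + y)
    simp only [map_add, LinearMap.add_apply, hB, zero_add, add_zero] at this
    exact eq_neg_of_add_eq_zero_right this
  obtain ⟨b, ρ, hρs, hρ⟩ := exists_coordinates (LinearMap.ker B) hn
  have hl : ∀ x, B x = B (∑ i, ρ x i • b i) := fun x => by
    rw [← sub_eq_zero, ← map_sub]; exact hρ x
  have hexpand : ∀ x y, bracketToSpan B x y =
      ∑ i, ∑ j, ρ x i • ρ y j • bracketToSpan B (b i) (b j) := by
    intro x y
    have h1 : bracketToSpan B x y = bracketToSpan B (∑ i, ρ x i • b i) (∑ j, ρ y j • b j) := by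
      apply Subtype.ext
      change B x y = B _ _
      rw [hl x, hanti, hl y, ← hanti]
    rw [h1]
    simp only [map_sum, map_smul, LinearMap.sum_apply, LinearMap.smul_apply, Finset.smul_sum]
    rw [Finset.sum_comm]
    exact Finset.sum_congr rfl fun i _ => Finset.sum_congr rfl fun j _ => smul_comm _ _ _
  have hspan : Submodule.span F {v | ∃ i j, bracketToSpan B (b i) (b j) = v} = ⊤ := by
    rw [eq_top_iff]
    rintro ⟨v, hv⟩ -
    induction hv using Submodule.span_induction with
    | mem v hv =>
      obtain ⟨x, y, rfl⟩ := hv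
      change bracketToSpan B x y ∈ _
      rw [hexpand]
      exact Submodule.sum_mem _ fun i _ => Submodule.sum_mem _ fun j _ => Submodule.smul_mem _ _
        (Submodule.smul_mem _ _ (Submodule.subset_span ⟨i, j, rfl⟩))
    | zero => exact zero_mem _
    | add u v hu hv h1 h2 => exact add_mem h1 h2
    | smul c u hu h1 => exact Submodule.smul_mem _ c h1
  obtain ⟨t, ht, htw⟩ := exists_jacobi_of_overlapBound_lt (fun i j => bracketToSpan B (b i) (b j))
    (fun i j => Subtype.ext (hanti _ _)) (fun i => Subtype.ext (hB _)) hspan hf w hw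
  have hsingle : ∀ v : Fin n → F, v = ∑ k, v k • Pi.single k 1 := fun v => by
    simpa using (Pi.basisFun F (Fin n)).sum_repr v |>.symm
  -- A Jacobi form on coordinates modulo the radical is pulled back to L along ρ.
  refine ⟨t.compl₂ ρ, ?_, ?_⟩
  · intro x y z
    simp only [LinearMap.compl₂_apply]
    have key : ∀ x y z, t (bracketToSpan B x y) (ρ z) = ∑ i, ∑ j, ∑ k,
        ρ x i * ρ y j * ρ z k * t (bracketToSpan B (b i) (b j)) (Pi.single k 1) := by
      intro x y z
      conv_lhs => rw [hexpand, hsingle (ρ z)]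
      simp only [map_sum, map_smul, LinearMap.sum_apply, LinearMap.smul_apply, smul_eq_mul]
      simp only [Finset.mul_sum]
      rw [Finset.sum_comm]
      refine Finset.sum_congr rfl fun i _ => ?_
      rw [Finset.sum_comm]
      refine Finset.sum_congr rfl fun j _ => Finset.sum_congr rfl fun k _ => ?_
      ring
    rw [key x y z, key y z x, key z x y]
    have e2 : ∑ j, ∑ k, ∑ i,
        ρ y j * ρ z k * ρ x i * t (bracketToSpan B (b j) (b k)) (Pi.single i 1) =
        ∑ i, ∑ j, ∑ k,
        ρ y j * ρ z k * ρ x i * t (bracketToSpan B (b j) (b k)) (Pi.single i 1) := by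
      rw [Finset.sum_congr rfl (fun i _ => Finset.sum_comm), Finset.sum_comm]
    have e3 : ∑ k, ∑ i, ∑ j,
        ρ z k * ρ x i * ρ y j * t (bracketToSpan B (b k) (b i)) (Pi.single j 1) =
        ∑ i, ∑ j, ∑ k,
        ρ z k * ρ x i * ρ y j * t (bracketToSpan B (b k) (b i)) (Pi.single j 1) := by
      rw [Finset.sum_comm]
      exact Finset.sum_congr rfl (fun i _ => Finset.sum_comm)
    rw [e2, e3]
    simp only [← Finset.sum_add_distrib]
    refine Finset.sum_eq_zero fun i _ => Finset.sum_eq_zero fun j _ =>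
      Finset.sum_eq_zero fun k _ => ?_
    linear_combination ρ x i * ρ y j * ρ z k * ht i j k
  · intro h
    apply htw
    refine LinearMap.ext fun v => ?_
    obtain ⟨z, rfl⟩ := hρs v
    exact LinearMap.congr_fun h z

theorem mainTheorem2 (p : ℕ) (hp : p.Prime) (hodd : Odd p)
    (G : Type*) [Group G] [Finite G]
    (hexp : Monoid.exponent G = p)
    (hclass : commutator G ≤ Subgroup.center G)
    (n m : ℕ)
    (hn : Group.rank (G ⧸ Subgroup.center G) = n)
    (hm : Group.rank (commutator G) = m) :
    (IsCapable G → n ≤ 2 * m + m.choose 2) ∧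
    (overlapBound (n.choose 2 - m + 1) < n → IsCapable G) := by
  have : Fact p.Prime := ⟨hp⟩
  have hexp' : ∀ g : G, g ^ p = 1 := fun g => hexp ▸ Monoid.pow_exponent_eq_one g
  obtain ⟨L, _, _, e, B, hB, hBB, he, heB⟩ := exists_baer p hodd G hexp' hclass
  have : Finite L := Finite.of_equiv G e
  have he1 : e 1 = 0 := by
    have := he 1 1
    rw [hB, smul_zero, add_zero, mul_one] at this
    exact left_eq_add.mp this
  have hcardF : ∀ N : Submodule (ZMod p) L, Nat.card N = p ^ Module.finrank (ZMod p) N := by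
    intro N
    have h := Module.natCard_eq_pow_finrank (K := ZMod p) (V := N)
    rwa [Nat.card_zmod] at h
  have hcenter : ∀ g, g ∈ Subgroup.center G ↔ e g ∈ LinearMap.ker B := by
    intro g
    rw [Subgroup.mem_center_iff, LinearMap.mem_ker]
    constructor
    · intro h
      ext y
      have h1 : ⁅g, e.symm y⁆ = 1 := commutatorElement_eq_one_iff_mul_comm.mpr (h _).symm
      have h2 := heB g (e.symm y)
      rw [h1, he1, e.apply_symm_apply] at h2
      exact h2.symm
    · intro h x
      refine (commutatorElement_eq_one_iff_mul_comm.mp (e.injective ?_)).symm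
      rw [heB, h, he1]; rfl
  have hcomm : ∀ g, g ∈ commutator G ↔ e g ∈ bracketSpan B := by
    intro g
    constructor
    · intro hg
      rw [commutator_eq_closure] at hg
      induction hg using Subgroup.closure_induction with
      | mem x hx =>
        obtain ⟨a, b, rfl⟩ := hx
        rw [heB]; exact bracket_mem_bracketSpan _ _ _
      | one => rw [he1]; exact zero_mem _
      | mul x y hx hy h1 h2 =>
        rw [he, bracket_eq_zero_of_mem_bracketSpan hBB h1, smul_zero, add_zero]
        exact add_mem h1 h2
      | inv x hx h1 =>
        have h2 := he x x⁻¹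
        rw [mul_inv_cancel, he1, bracket_eq_zero_of_mem_bracketSpan hBB h1, smul_zero,
          add_zero] at h2
        rw [eq_neg_of_add_eq_zero_right h2.symm]
        exact neg_mem h1
    · suffices ∀ u ∈ bracketSpan B, e.symm u ∈ commutator G by
        intro h; simpa using this _ h
      intro u hu
      have hgen : ∀ x y, e.symm (B x y) ∈ commutator G := fun x y => by
        have := heB (e.symm x) (e.symm y)
        rw [e.apply_symm_apply, e.apply_symm_apply] at this
        rw [← this, e.symm_apply_apply]
        exact Subgroup.commutator_mem_commutator (Subgroup.mem_top _) (Subgroup.mem_top _)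
      have hadd : ∀ x ∈ bracketSpan B, ∀ y, e.symm (x + y) = e.symm x * e.symm y := by
        intro x hx y
        apply e.injective
        rw [he, e.apply_symm_apply, e.apply_symm_apply, e.apply_symm_apply,
          bracket_eq_zero_of_mem_bracketSpan hBB hx, smul_zero, add_zero]
      refine Submodule.closure_induction (R := ZMod p) (s := {w | ∃ x y, B x y = w})
        (p := fun u _ => e.symm u ∈ commutator G) ?_ ?_ ?_ hu
      · rw [← he1, e.symm_apply_apply]; exact one_mem _
      · intro x y hx hy h1 h2
        rw [hadd x hx]; exact mul_mem h1 h2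
      -- A scalar multiple of a bracket is again a bracket.
      · rintro c _ ⟨x, y, rfl⟩
        rw [← LinearMap.smul_apply, ← map_smul]
        exact hgen _ _
  have hZ : Nat.card (Subgroup.center G) = p ^ Module.finrank (ZMod p) (LinearMap.ker B) := by
    rw [← hcardF]
    exact Nat.card_congr (e.subtypeEquiv hcenter)
  have hW : Nat.card (commutator G) = p ^ Module.finrank (ZMod p) (bracketSpan B) := by
    rw [← hcardF]
    exact Nat.card_congr (e.subtypeEquiv hcomm)
  have hG : Nat.card G = p ^ Module.finrank (ZMod p) L := by
    rw [Nat.card_congr e]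
    have h := Module.natCard_eq_pow_finrank (K := ZMod p) (V := L)
    rwa [Nat.card_zmod] at h
  have hm' : Module.finrank (ZMod p) (bracketSpan B) = m := by
    have h := card_eq_pow_rank (A := commutator G) (p := p)
      (fun a b => Subtype.ext (Subgroup.mem_center_iff.mp (hclass b.2) a.1))
      (fun a => Subtype.ext (hexp' a.1))
    rw [hW, hm] at h
    exact Nat.pow_right_injective hp.two_le h
  have hn' : n + Module.finrank (ZMod p) (LinearMap.ker B) = Module.finrank (ZMod p) L := by
    have h := card_eq_pow_rank (A := G ⧸ Subgroup.center G) (p := p)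
      (fun a b => by
        induction a using QuotientGroup.induction_on with | _ a
        induction b using QuotientGroup.induction_on with | _ b
        rw [← QuotientGroup.mk_mul, ← QuotientGroup.mk_mul, QuotientGroup.eq]
        have : (a * b)⁻¹ * (b * a) = ⁅b⁻¹, a⁻¹⁆ := by
          simp only [commutatorElement_def]; group
        rw [this]
        exact hclass (Subgroup.commutator_mem_commutator (Subgroup.mem_top _)
          (Subgroup.mem_top _)))
      (fun a => by
        induction a using QuotientGroup.induction_on with | _ a
        rw [← QuotientGroup.mk_pow, hexp']; rfl)
    rw [hn] at h
    have h2 := Subgroup.card_eq_card_quotient_mul_card_subgroup (Subgroup.center G)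
    rw [h, hZ, hG, ← pow_add] at h2
    exact (Nat.pow_right_injective hp.two_le h2).symm
  constructor
  · intro hcap
    have hker : LinearMap.ker (bracketToSpan B) = LinearMap.ker B := by
      ext x
      simp only [LinearMap.mem_ker, LinearMap.ext_iff]
      exact forall_congr' fun y => Subtype.ext_iff
    have h := finrank_le_of_jacobi (bracketToSpan B) (fun x => Subtype.ext (hB x))
      (fun w hw => exists_jacobi_of_isCapable hexp' hcap e B hB hBB he heB w hw)
    rw [hker, hm'] at h
    have h2 : (m + 1).choose 2 = m + m.choose 2 := by
      rw [Nat.choose_succ_succ' m 1, Nat.choose_one_right]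
    omega
  · intro hf
    refine isCapable_of_jacobi hodd e B hB hBB he ?_ fun w hw =>
      exists_jacobi_bracketSpan B hB hn' (by rwa [hm']) w hw
    -- If the bracket vanished, n would be 0, and no value of f lies below 0.
    rintro rfl
    rw [LinearMap.ker_zero, finrank_top] at hn'
    omega
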